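/- Let $\mathbb R^3_1$ be $\mathbb R^3$ with the Lorentzian metric $\langle a,b\rangle=-a_1b_1+a_2b_2+a_3b_3$ and cross product $a\boxtimes b=(a_3b_2-a_2b_3,\,a_3b_1-a_1b_3,\,a_1b_2-a_2b_1)$. For $c<0$ let $\mathbb H^2(c)=\{x\in\mathbb R^3_1 \mid \langle x,x\rangle=1/c,\ x_1>0\}$ be the hyperbolic plane of curvature $c$, and write $\mathbb H^2=\mathbb H^2(-1)$. Equip $\mathbb H^2\times\mathbb H^2\subset\mathbb R^3_1\times\mathbb R^3_1$ with the product metric and the complex structure $J_{(x_1,x_2)}(v_1,v_2)=(x_1\boxtimes v_1,\,-x_2\boxtimes v_2)$. An isometry $F$ of $\mathbb H^2\times\mathbb H^2$ is holomorphic if $dF\circ J=J\circ dF$ and anti-holomorphic if $dF\circ J=-J\circ dF$. The diagonal is the image of $\mathbb H^2(-1/2)\to\mathbb H^2\times\mathbb H^2$, $x\mapsto\frac1{\sqrt2}(x,x)$. Let $\Phi:\Sigma\to\mathbb H^2\times\mathbb H^2$ be a smooth immersion of a connected surface which is Lagrangian, i.e. $J$ maps each tangent plane to its orthogonal complement. Let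 $h$ be its second fundamental form. **Theorem.** $\Phi$ is totally geodesic ($h=0$) if and only if at least one of the following holds: (a) the image of $\Phi$ is an open part (i.e. a relatively open subset) of a product of geodesics $\{(\beta_1(s_1),\beta_2(s_2)) \mid s_1\in I_1,\ s_2\in I_2\}$, where $I_1,I_2\subseteq\mathbb R$ are non-empty open intervals and $\beta_j:I_j\to\mathbb H^2$ are geodesics parametrized by arc length; (b) up to a holomorphic or anti-holomorphic isometry of $\mathbb H^2\times\mathbb H^2$, the image of $\Phi$ is an open part of the diagonal. Moreover, $\Phi$ is totally umbilical (at each point there is a vector $H$ with $h(X,Y)=\langle X,Y\rangle H$ for all tangent vectors $X,Y$) if and only if (a) or (b) holds. -/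

import Mathlib

open scoped Manifold ContDiff

noncomputable section

namespace LagHH

/-- The vector space underlying the Minkowski space `ℝ³₁`. -/
abbrev R3 : Type := Fin 3 → ℝ

/-- The vector space underlying `ℝ³₁ × ℝ³₁ ≅ ℝ⁶₂`. -/
abbrev R6 : Type := R3 × R3

/-- The plane on which surfaces are modelled. -/
abbrev E2 : Type := EuclideanSpace ℝ (Fin 2)

/-- The Lorentzian metric of index one on `ℝ³₁`. -/
def mink (a b : R3) : ℝ := -(a 0 * b 0) + a 1 * b 1 + a 2 * b 2

/-- The Lorentzian cross product on `ℝ³₁`. -/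
def lcross (a b : R3) : R3 :=
  ![a 2 * b 1 - a 1 * b 2, a 2 * b 0 - a 0 * b 2, a 0 * b 1 - a 1 * b 0]

/-- The hyperbolic plane of constant curvature `c < 0`, as one sheet of a hyperboloid. -/
def hypPlane (c : ℝ) : Set R3 := {x | mink x x = 1 / c ∧ 0 < x 0}

/-- The orthogonal projection of `ℝ³₁` onto the tangent plane `{v | mink x v = 0}` of
`hypPlane (-1)` at its point `x`. -/
def projHyp (x v : R3) : R3 := v + mink x v • x

/-- The product `ℍ² × ℍ²` of two hyperbolic planes of curvature `-1`. -/
def HH : Set R6 := hypPlane (-1) ×ˢ hypPlane (-1)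

/-- The tangent space of `ℍ² × ℍ²` at its point `x`. -/
def tangentHH (x : R6) : Set R6 := {v | mink x.1 v.1 = 0 ∧ mink x.2 v.2 = 0}

/-- The product metric; on tangent vectors of `ℍ² × ℍ²` this is the Riemannian product metric. -/
def metric6 (v w : R6) : ℝ := mink v.1 w.1 + mink v.2 w.2

/-- The complex structure `J = (J_{ℍ²}, -J_{ℍ²})`, where `J_{ℍ²}` at `x` is `v ↦ x ⊠ v`. -/
def complexJ (x v : R6) : R6 := (lcross x.1 v.1, -lcross x.2 v.2)

/-- The Kähler two-form `ω = ⟨J ·, ·⟩`. -/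
def kaehler (x v w : R6) : ℝ := metric6 (complexJ x v) w

/-- The orthogonal projection of `ℝ⁶₂` onto the tangent space of `ℍ² × ℍ²` at `x`. -/
def projHH (x v : R6) : R6 := (projHyp x.1 v.1, projHyp x.2 v.2)

/-! ### Isometries of `ℍ² × ℍ²` -/

/-- `F` restricts to a Riemannian isometry of `ℍ² × ℍ²` onto itself: it is smooth near `ℍ² × ℍ²`,
maps it bijectively to itself, and its differential preserves the metric on tangent vectors.
(The values of `F` off `ℍ² × ℍ²` play no role.) -/
structure IsIsometryHH (F : R6 → R6) : Prop where
  smooth : ∃ U : Set R6, IsOpen U ∧ HH ⊆ U ∧ ContDiffOn ℝ ∞ F U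
  bijOn : Set.BijOn F HH HH
  metric : ∀ x ∈ HH, ∀ v ∈ tangentHH x, ∀ w ∈ tangentHH x,
    metric6 (fderiv ℝ F x v) (fderiv ℝ F x w) = metric6 v w

/-- The differential of `F` commutes with `J`. -/
def IsHolomorphicHH (F : R6 → R6) : Prop :=
  ∀ x ∈ HH, ∀ v ∈ tangentHH x,
    fderiv ℝ F x (complexJ x v) = complexJ (F x) (fderiv ℝ F x v)

/-- The differential of `F` anticommutes with `J`. -/
def IsAntiholomorphicHH (F : R6 → R6) : Prop :=
  ∀ x ∈ HH, ∀ v ∈ tangentHH x,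
    fderiv ℝ F x (complexJ x v) = -complexJ (F x) (fderiv ℝ F x v)

/-! ### Immersed surfaces in `ℍ² × ℍ²` -/

section Surface

variable {M : Type*} [TopologicalSpace M] [ChartedSpace E2 M]

/-- The differential of `Φ` at `p`; `T_p M` is identified with `E2` by the preferred chart
at `p`, as in Mathlib. -/
def diff (Φ : M → R6) (p : M) : E2 →L[ℝ] R6 := mfderiv 𝓘(ℝ, E2) 𝓘(ℝ, R6) Φ p

/-- `Φ` is a smooth immersion of the surface `M` into the submanifold `ℍ² × ℍ²` of `ℝ⁶₂`. -/
structure IsImmersionHH (Φ : M → R6) : Prop where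
  smooth : ContMDiff 𝓘(ℝ, E2) 𝓘(ℝ, R6) ∞ Φ
  mem : ∀ p, Φ p ∈ HH
  injective : ∀ p, Function.Injective (diff Φ p)

/-- All tangent planes of `Φ` are Lagrangian: `J` maps each of them to its orthogonal
complement. -/
def IsLagrangian (Φ : M → R6) : Prop :=
  ∀ p, ∀ u v : E2, kaehler (Φ p) (diff Φ p u) (diff Φ p v) = 0

/-- The induced metric on `T_p M`. -/
def inducedMetric (Φ : M → R6) (p : M) (u v : E2) : ℝ := metric6 (diff Φ p u) (diff Φ p v)

/-- The second derivative `∂_u ∂_v Φ` at `p`, in the preferred chart at `p`. -/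
def hess (Φ : M → R6) (p : M) (u v : E2) : R6 :=
  fderiv ℝ (fun y : E2 => fderiv ℝ (fun z : E2 => Φ ((chartAt E2 p).symm z)) y v)
    (chartAt E2 p p) u

/-- The image under `Φ` of the `i`-th coordinate vector of `T_p M`. -/
def frame (Φ : M → R6) (p : M) (i : Fin 2) : R6 := diff Φ p (EuclideanSpace.single i 1)

/-- The Gram matrix of the coordinate vectors, i.e. the matrix `(g_{ij})` of the induced metric. -/
def gram (Φ : M → R6) (p : M) : Matrix (Fin 2) (Fin 2) ℝ :=
  Matrix.of fun i j => metric6 (frame Φ p i) (frame Φ p j)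

/-- The orthogonal projection `∑ g^{ij} ⟨w, e_i⟩ e_j` of `w` onto the tangent plane of `Φ`
at `p`. -/
def tangentPart (Φ : M → R6) (p : M) (w : R6) : R6 :=
  ∑ i, ∑ j, ((gram Φ p)⁻¹ i j * metric6 w (frame Φ p i)) • frame Φ p j

/-- The second fundamental form `h(u, v)` of `Φ` as a surface in `ℍ² × ℍ²`. For coordinate vector
fields `u`, `v` the Levi-Civita derivative `∇_u Φ_* v` in `ℍ² × ℍ²` is `projHH (hess u v)`, and
`h(u, v)` is its component normal to `Φ`. -/
def sff (Φ : M → R6) (p : M) (u v : E2) : R6 :=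
  projHH (Φ p) (hess Φ p u v) - tangentPart Φ p (projHH (Φ p) (hess Φ p u v))

/-- `Φ` is totally geodesic: its second fundamental form vanishes. -/
def IsTotallyGeodesic (Φ : M → R6) : Prop := ∀ p, ∀ u v : E2, sff Φ p u v = 0

/-- `Φ` is totally umbilical: `h(u, v) = ⟨u, v⟩ H` for a vector `H` at each point (which is then
necessarily the mean curvature vector). -/
def IsTotallyUmbilical (Φ : M → R6) : Prop :=
  ∀ p, ∃ H : R6, ∀ u v : E2, sff Φ p u v = inducedMetric Φ p u v • H

end Surface

/-! ### The model surfaces -/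

/-- `I` is a non-empty open interval of `ℝ`, and `β : I → ℍ²` is a smooth geodesic parametrized by
arc length: the covariant derivative of `β'` along `β` vanishes. -/
structure IsUnitSpeedGeodesic (I : Set ℝ) (β : ℝ → R3) : Prop where
  isOpen : IsOpen I
  ordConnected : I.OrdConnected
  nonempty : I.Nonempty
  smooth : ContDiffOn ℝ ∞ β I
  mem : ∀ s ∈ I, β s ∈ hypPlane (-1)
  unitSpeed : ∀ s ∈ I, mink (deriv β s) (deriv β s) = 1
  geodesic : ∀ s ∈ I, projHyp (β s) (deriv (deriv β) s) = 0

/-- The image of `(s₁, s₂) ↦ (β₁ s₁, β₂ s₂)` on `I₁ × I₂`. -/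
def productOfCurves (I₁ I₂ : Set ℝ) (β₁ β₂ : ℝ → R3) : Set R6 := (β₁ '' I₁) ×ˢ (β₂ '' I₂)

/-- The image of the diagonal immersion `x ↦ (x, x) / √2` of the hyperbolic plane of
curvature `-1/2`. -/
def diagonal : Set R6 :=
  (fun x : R3 => ((√2)⁻¹ • x, (√2)⁻¹ • x)) '' hypPlane (-1 / 2)

/-- `S` is an open part of `T`, i.e. a relatively open subset of it. -/
def IsOpenPart (S T : Set R6) : Prop := ∃ U : Set R6, IsOpen U ∧ S = U ∩ T

/-- The image of `Φ` is (an open part of) a product of two geodesics of `ℍ²`. -/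
def IsProductOfGeodesics {M : Type*} (Φ : M → R6) : Prop :=
  ∃ (I₁ I₂ : Set ℝ) (β₁ β₂ : ℝ → R3),
    IsUnitSpeedGeodesic I₁ β₁ ∧ IsUnitSpeedGeodesic I₂ β₂ ∧
      IsOpenPart (Set.range Φ) (productOfCurves I₁ I₂ β₁ β₂)

/-- Up to a holomorphic or anti-holomorphic isometry of `ℍ² × ℍ²`, the image of `Φ` is an open
part of the diagonal. -/
def IsCongruentToDiagonal {M : Type*} (Φ : M → R6) : Prop :=
  ∃ F : R6 → R6, IsIsometryHH F ∧ (IsHolomorphicHH F ∨ IsAntiholomorphicHH F) ∧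
    IsOpenPart (F '' Set.range Φ) diagonal

end LagHH

end

/-! Write g₁, g₂ for the metrics pulled back by the two projections Φ₁, Φ₂. As J has opposite signs
on the factors, Lagrangian means that Φ₁ and Φ₂ pull back the same area form (`triple_eq`). Hence at
each point both projections are immersions or neither is (`fst_iff_snd`).

Umbilical implies totally geodesic because ⟨h(X,Y),JZ⟩ is totally symmetric
(`LagSurface.cubic_symm`): for X ⟂ Z with X ≠ 0, |X|²⟨H,JZ⟩ = ⟨X,Z⟩⟨H,JX⟩ = 0, so H has no component
along J of the tangent plane.

Let h = 0. Then Φ₁ and Φ₂ are both affine for the connection Γ of the surface, and the Gauss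
equation of either factor computes the same curvature tensor (`curvature_identity`). Where both are
immersions this forces g₁ = g₂ (`GeodesicSurface.pull_eq`). Being immersive is an open condition and
g₁ = g₂ a closed one, so by connectedness one alternative holds on all of M (`equalPullbacks_or`).
Unique continuation (`clm_eq_zero_of_base`) makes this global. From D²Φ = dΦ(Γ) + (g₁Φ₁, g₂Φ₂), the
function L∘Φ with L linear obeys a linear second order system if L reads only one factor or if g₁ =
g₂; it then vanishes once its 1-jet vanishes at one point. If g₁ = g₂, take L = A∘pr₁ − pr₂, where
the Lorentz map A matches the 1-jets of Φ₁ and Φ₂ at a point: then Φ₂ = AΦ₁, and (A, id) moves the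
surface into the diagonal. Equality of the area forms makes A orientation preserving, so a
holomorphic isometry always suffices. In the degenerate case both projections have rank one, and L
is the pairing with the normal of the plane through the origin that contains a tangent geodesic.

Conversely, both models are cut out of ℍ² × ℍ² by homogeneous linear equations. Differentiating
these twice shows that the covariant second derivatives are tangent to the surface. For the diagonal
this is transported through the isometry by Koszul's formula (`metric6_D2_eq`). -/

noncomputable section

namespace LagHH

/-! ### Lorentzian linear algebra -/

/-- The Lorentzian metric as a continuous bilinear map. -/
def minkL : R3 →L[ℝ] R3 →L[ℝ] ℝ :=
  (LinearMap.mk₂ ℝ mink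
    (by intros; simp [mink]; ring) (by intros; simp [mink]; ring)
    (by intros; simp [mink]; ring) (by intros; simp [mink]; ring)).toContinuousBilinearMap

@[simp] lemma minkL_apply (a b : R3) : minkL a b = mink a b := rfl

/-- The Lorentzian cross product as a continuous bilinear map. -/
def lcrossL : R3 →L[ℝ] R3 →L[ℝ] R3 :=
  (LinearMap.mk₂ ℝ lcross
    (by intros; ext i; fin_cases i <;> simp [lcross] <;> ring)
    (by intros; ext i; fin_cases i <;> simp [lcross] <;> ring)
    (by intros; ext i; fin_cases i <;> simp [lcross] <;> ring)
    (by intros; ext i; fin_cases i <;> simp [lcross] <;> ring)).toContinuousBilinearMap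

@[simp] lemma lcrossL_apply (a b : R3) : lcrossL a b = lcross a b := rfl

lemma mink_comm (a b : R3) : mink a b = mink b a := by simp [mink]; ring
lemma mink_add_left (a b c : R3) : mink (a + b) c = mink a c + mink b c := by simp [mink]; ring
lemma mink_add_right (a b c : R3) : mink a (b + c) = mink a b + mink a c := by simp [mink]; ring
lemma mink_sub_left (a b c : R3) : mink (a - b) c = mink a c - mink b c := by simp [mink]; ring
lemma mink_sub_right (a b c : R3) : mink a (b - c) = mink a b - mink a c := by simp [mink]; ring
lemma mink_neg_left (a b : R3) : mink (-a) b = -mink a b := by simp [mink]; ring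
lemma mink_neg_right (a b : R3) : mink a (-b) = -mink a b := by simp [mink]; ring
lemma mink_smul_left (t : ℝ) (a b : R3) : mink (t • a) b = t * mink a b := by
  simp [mink]; ring
lemma mink_smul_right (t : ℝ) (a b : R3) : mink a (t • b) = t * mink a b := by
  simp [mink]; ring
@[simp] lemma mink_zero_left (a : R3) : mink 0 a = 0 := by simp [mink]
@[simp] lemma mink_zero_right (a : R3) : mink a 0 = 0 := by simp [mink]

lemma lcross_self (a : R3) : lcross a a = 0 := by
  ext i; fin_cases i <;> simp [lcross] <;> ring

lemma lcross_neg_comm (a b : R3) : lcross a b = -lcross b a := by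
  ext i; fin_cases i <;> simp [lcross] <;> ring

lemma mink_lcross_left (a b : R3) : mink (lcross a b) a = 0 := by simp [mink, lcross]; ring
lemma mink_lcross_right (a b : R3) : mink (lcross a b) b = 0 := by simp [mink, lcross]; ring

lemma mink_lcross_swap (a b c : R3) : mink (lcross a b) c = -mink (lcross a c) b := by
  simp [mink, lcross]; ring

lemma mink_lcross_lcross (a b c d : R3) :
    mink (lcross a b) (lcross c d) = mink a d * mink b c - mink a c * mink b d := by
  simp [mink, lcross]; ring

lemma lcross_lcross (a b c : R3) : lcross a (lcross b c) = mink a b • c - mink a c • b := by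
  ext i; fin_cases i <;> simp [mink, lcross] <;> ring

/-- Cramer's rule: up to the triple product, the three cross products are the dual basis of `a, b,
c`. As a polynomial identity it needs no independence. -/
lemma smul_triple (a b c v : R3) :
    mink (lcross a b) c • v =
      mink v a • lcross b c + mink v b • lcross c a + mink v c • lcross a b := by
  ext i; fin_cases i <;> simp [mink, lcross] <;> ring

lemma lcross_add_left (a b c : R3) : lcross (a + b) c = lcross a c + lcross b c :=
  lcrossL.map_add₂ a b c
lemma lcross_add_right (a b c : R3) : lcross a (b + c) = lcross a b + lcross a c :=
  (lcrossL a).map_add b c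
lemma lcross_smul_left (t : ℝ) (a b : R3) : lcross (t • a) b = t • lcross a b :=
  lcrossL.map_smul₂ t a b
lemma lcross_smul_right (t : ℝ) (a b : R3) : lcross a (t • b) = t • lcross a b :=
  (lcrossL a).map_smul t b

lemma mem_hyp {x : R3} : x ∈ hypPlane (-1) ↔ mink x x = -1 ∧ 0 < x 0 := by
  simp [hypPlane]

/-- By Lagrange's identity the two sides differ by `(x 1 * v 2 - x 2 * v 1) ^ 2`. This is the source
of positive definiteness on tangent planes. -/
lemma mink_self_ge {x v : R3} (hx : mink x x = -1) (h : mink x v = 0) :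
    v 1 ^ 2 + v 2 ^ 2 ≤ mink v v * x 0 ^ 2 := by
  simp only [mink] at *
  have h0 : x 0 * v 0 = x 1 * v 1 + x 2 * v 2 := by linarith
  have h1 : x 0 ^ 2 = 1 + x 1 ^ 2 + x 2 ^ 2 := by nlinarith
  have h2 : (x 0 * v 0) ^ 2 = (x 1 * v 1 + x 2 * v 2) ^ 2 := by rw [h0]
  nlinarith [sq_nonneg (x 1 * v 2 - x 2 * v 1)]

lemma sq_zero_ge {x : R3} (hx : mink x x = -1) : 1 ≤ x 0 ^ 2 := by
  simp only [mink] at hx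
  nlinarith [sq_nonneg (x 1), sq_nonneg (x 2)]

lemma mink_self_nonneg {x v : R3} (hx : mink x x = -1) (h : mink x v = 0) : 0 ≤ mink v v := by
  have h1 := mink_self_ge hx h
  have h2 := sq_zero_ge hx
  by_contra hn
  nlinarith [sq_nonneg (v 1), sq_nonneg (v 2)]

/-- Orthogonality to `x` determines `v 0`, because `x 0 ≠ 0`. Thus the last two coordinates are
linear coordinates on every tangent plane. -/
lemma eq_zero_of_coords {x v : R3} (hx : mink x x = -1) (h : mink x v = 0) (h1 : v 1 = 0)
    (h2 : v 2 = 0) : v = 0 := by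
  have h3 := sq_zero_ge hx
  have h4 : x 0 * v 0 = 0 := by simp only [mink, h1, h2] at h; linarith
  have h5 : x 0 ≠ 0 := by rintro h; rw [h] at h3; norm_num at h3
  have h6 : v 0 = 0 := by simpa [h5] using h4
  ext i; fin_cases i <;> simp [h1, h2, h6]

lemma eq_zero_of_mink_self {x v : R3} (hx : mink x x = -1) (h : mink x v = 0)
    (h0 : mink v v = 0) : v = 0 := by
  have h1 := mink_self_ge hx h
  rw [h0] at h1
  exact eq_zero_of_coords hx h (by nlinarith [sq_nonneg (v 1), sq_nonneg (v 2)])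
    (by nlinarith [sq_nonneg (v 1), sq_nonneg (v 2)])

/-- The reversed Cauchy–Schwarz inequality for timelike vectors on the same sheet. -/
lemma mink_neg_of_mem {x y : R3} (hx : x ∈ hypPlane (-1)) (hy : y ∈ hypPlane (-1)) :
    mink x y < 0 := by
  rw [mem_hyp] at hx hy
  obtain ⟨hx, hx0⟩ := hx
  obtain ⟨hy, hy0⟩ := hy
  simp only [mink] at *
  have h1 : (x 1 * y 1 + x 2 * y 2) ^ 2 < (x 0 * y 0) ^ 2 := by
    have : (x 0 * y 0) ^ 2 = (1 + x 1 ^ 2 + x 2 ^ 2) * (1 + y 1 ^ 2 + y 2 ^ 2) := by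
      rw [mul_pow, show x 0 ^ 2 = 1 + x 1 ^ 2 + x 2 ^ 2 by nlinarith,
        show y 0 ^ 2 = 1 + y 1 ^ 2 + y 2 ^ 2 by nlinarith]
    rw [this]
    nlinarith [sq_nonneg (x 1 * y 2 - x 2 * y 1), sq_nonneg (x 1), sq_nonneg (x 2),
      sq_nonneg (y 1), sq_nonneg (y 2)]
  have := lt_of_pow_lt_pow_left₀ 2 (mul_pos hx0 hy0).le h1
  linarith

/-- Otherwise `-z` would lie on the sheet of `x` and `mink_neg_of_mem` would give the wrong sign. A
single test point thus shows that a linear isometry preserves the sheet. -/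
lemma mem_hyp_of_mink_neg {x z : R3} (hx : x ∈ hypPlane (-1)) (hz : mink z z = -1)
    (h : mink z x < 0) : z ∈ hypPlane (-1) := by
  rw [mem_hyp]
  refine ⟨hz, ?_⟩
  by_contra hn
  have h1 := sq_zero_ge hz
  have h2 : z 0 < 0 := lt_of_le_of_ne (not_lt.1 hn) (by rintro h; rw [h] at h1; norm_num at h1)
  have h3 : -z ∈ hypPlane (-1) := by
    rw [mem_hyp]; exact ⟨by simpa [mink] using hz, by simpa using h2⟩
  have := mink_neg_of_mem h3 hx
  rw [mink_neg_left] at this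
  linarith

/-- Expansion in the orthonormal frame `(x, a, x ⊠ a)`. -/
lemma frame_expand {x a : R3} (hx : mink x x = -1) (ha : mink a a = 1) (hxa : mink x a = 0)
    (v : R3) : v = (-mink v x) • x + mink v a • a + mink v (lcross x a) • lcross x a := by
  have h1 : mink (lcross x a) (lcross x a) = 1 := by
    rw [mink_lcross_lcross, hx, ha, hxa, mink_comm a x, hxa]; norm_num
  have h := smul_triple x a (lcross x a) v
  rw [h1, one_smul, lcross_lcross, lcross_neg_comm (lcross x a) x, lcross_lcross, hxa, hx,
    mink_comm a x, hxa, ha] at h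
  calc v = _ := h
    _ = _ := by module

/-- The linear map carrying the frame `(x, a, x ⊠ a)` to `(y, b, y ⊠ b)`. -/
def frameMap (x a y b : R3) : R3 →L[ℝ] R3 :=
  -((minkL x).smulRight y) + (minkL a).smulRight b + (minkL (lcross x a)).smulRight (lcross y b)

lemma frameMap_apply (x a y b v : R3) : frameMap x a y b v =
    (-mink v x) • y + mink v a • b + mink v (lcross x a) • lcross y b := by
  simp [frameMap, mink_comm v]

/-- `a` is a unit tangent vector of the hyperbolic plane at `x`. -/
structure UnitTangent (x a : R3) : Prop where
  base : x ∈ hypPlane (-1)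
  unit : mink a a = 1
  orth : mink x a = 0

namespace UnitTangent
variable {x a y b : R3} (h : UnitTangent x a) (k : UnitTangent y b)
include h

lemma sq : mink x x = -1 := (mem_hyp.1 h.base).1

lemma unit_cross : mink (lcross x a) (lcross x a) = 1 := by
  rw [mink_lcross_lcross, h.sq, h.unit, h.orth, mink_comm a x, h.orth]; norm_num

lemma expand (v : R3) :
    v = (-mink v x) • x + mink v a • a + mink v (lcross x a) • lcross x a :=
  frame_expand h.sq h.unit h.orth v

lemma frameMap_base : frameMap x a y b x = y := by
  rw [frameMap_apply, h.sq, h.orth, mink_comm, mink_lcross_left]; simp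

lemma frameMap_unit : frameMap x a y b a = b := by
  rw [frameMap_apply, mink_comm a x, h.orth, h.unit, mink_comm, mink_lcross_right]; simp

lemma frameMap_cross : frameMap x a y b (lcross x a) = lcross y b := by
  rw [frameMap_apply, mink_lcross_left, mink_lcross_right, h.unit_cross]; simp

include k

lemma mink_frameMap (v w : R3) : mink (frameMap x a y b v) (frameMap x a y b w) = mink v w := by
  conv_rhs => rw [h.expand v, h.expand w]
  simp only [frameMap_apply, mink_add_left, mink_add_right, mink_smul_left, mink_smul_right,
    h.sq, k.sq, h.unit, k.unit, h.unit_cross, k.unit_cross, h.orth, k.orth, mink_comm a x,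
    mink_comm b y, mink_lcross_left, mink_lcross_right, mink_comm x (lcross x a),
    mink_comm a (lcross x a), mink_comm y (lcross y b), mink_comm b (lcross y b)]

/-- Both frames end with the cross product of their first two vectors, so they have the same
orientation. This is what makes the isometries built from `frameMap` holomorphic. -/
lemma lcross_frameMap (v w : R3) : lcross (frameMap x a y b v) (frameMap x a y b w) =
    frameMap x a y b (lcross v w) := by
  conv_rhs => rw [h.expand v, h.expand w]
  simp only [frameMap_apply _ _ _ _ v, frameMap_apply _ _ _ _ w, lcross_add_left,
    lcross_add_right, lcross_smul_left,
    lcross_smul_right, lcross_self, lcross_neg_comm a x, lcross_neg_comm b y,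
    lcross_neg_comm (lcross x a) x, lcross_neg_comm (lcross x a) a,
    lcross_neg_comm (lcross y b) y, lcross_neg_comm (lcross y b) b,
    lcross_lcross x x a, lcross_lcross a x a, lcross_lcross y y b, lcross_lcross b y b, h.sq, k.sq,
    h.orth, k.orth, h.unit, k.unit, mink_comm a x, mink_comm b y, map_add, map_smul, map_neg,
    map_sub, map_zero, h.frameMap_base, h.frameMap_unit, h.frameMap_cross]

lemma frameMap_frameMap (v : R3) : frameMap y b x a (frameMap x a y b v) = v := by
  conv_rhs => rw [h.expand v]
  rw [frameMap_apply x a y b v]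
  simp only [map_add, map_smul, k.frameMap_base, k.frameMap_unit, k.frameMap_cross]

lemma frameMap_mem {v : R3} (hv : v ∈ hypPlane (-1)) :
    frameMap x a y b v ∈ hypPlane (-1) := by
  refine mem_hyp_of_mink_neg k.base ?_ ?_
  · rw [h.mink_frameMap k]; exact (mem_hyp.1 hv).1
  · have := h.mink_frameMap k v x
    rw [h.frameMap_base] at this
    rw [this]; exact mink_neg_of_mem hv h.base

end UnitTangent

/-! ### The product metric -/

/-- `metric6` as a continuous bilinear map. -/
def metricL : R6 →L[ℝ] R6 →L[ℝ] ℝ :=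
  (LinearMap.mk₂ ℝ metric6
    (by intros; simp [metric6, mink]; ring) (by intros; simp [metric6, mink]; ring)
    (by intros; simp [metric6, mink]; ring)
    (by intros; simp [metric6, mink]; ring)).toContinuousBilinearMap

@[simp] lemma metricL_apply (a b : R6) : metricL a b = metric6 a b := rfl

lemma metric6_comm (a b : R6) : metric6 a b = metric6 b a := by
  simp [metric6, mink_comm a.1, mink_comm a.2]
lemma metric6_add_left (a b c : R6) : metric6 (a + b) c = metric6 a c + metric6 b c :=
  metricL.map_add₂ a b c
lemma metric6_sub_left (a b c : R6) : metric6 (a - b) c = metric6 a c - metric6 b c :=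
  metricL.map_sub₂ a b c
lemma metric6_smul_left (t : ℝ) (a b : R6) : metric6 (t • a) b = t * metric6 a b :=
  metricL.map_smul₂ t a b
lemma metric6_add_right (a b c : R6) : metric6 a (b + c) = metric6 a b + metric6 a c :=
  (metricL a).map_add b c
lemma metric6_smul_right (t : ℝ) (a b : R6) : metric6 a (t • b) = t * metric6 a b :=
  (metricL a).map_smul t b
@[simp] lemma metric6_zero_left (a : R6) : metric6 0 a = 0 := by simp [metric6]
@[simp] lemma metric6_zero_right (a : R6) : metric6 a 0 = 0 := by simp [metric6]

lemma HH.sq_fst {x : R6} (hx : x ∈ HH) : mink x.1 x.1 = -1 := (mem_hyp.1 hx.1).1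
lemma HH.sq_snd {x : R6} (hx : x ∈ HH) : mink x.2 x.2 = -1 := (mem_hyp.1 hx.2).1

/-- The tangent space of `ℍ² × ℍ²` as a submodule. -/
def tangentSub (x : R6) : Submodule ℝ R6 where
  carrier := tangentHH x
  add_mem' := by
    rintro a b ⟨h1, h2⟩ ⟨h3, h4⟩
    exact ⟨by simp [mink_add_right, h1, h3], by simp [mink_add_right, h2, h4]⟩
  zero_mem' := ⟨by simp, by simp⟩
  smul_mem' := by
    rintro t a ⟨h1, h2⟩
    exact ⟨by simp [mink_smul_right, h1], by simp [mink_smul_right, h2]⟩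

lemma eq_zero_of_metric6_self {x v : R6} (hx : x ∈ HH) (hv : v ∈ tangentHH x)
    (h : metric6 v v = 0) : v = 0 := by
  have h1 := mink_self_nonneg (HH.sq_fst hx) hv.1
  have h2 := mink_self_nonneg (HH.sq_snd hx) hv.2
  unfold metric6 at h
  exact Prod.ext (eq_zero_of_mink_self (HH.sq_fst hx) hv.1 (by linarith))
    (eq_zero_of_mink_self (HH.sq_snd hx) hv.2 (by linarith))

lemma projHH_mem {x : R6} (hx : x ∈ HH) (v : R6) : projHH x v ∈ tangentHH x := by
  constructor
  · simp [projHH, projHyp, mink_add_right, mink_smul_right, HH.sq_fst hx]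
  · simp [projHH, projHyp, mink_add_right, mink_smul_right, HH.sq_snd hx]

lemma metric6_projHH {x : R6} (v : R6) {w : R6} (hw : w ∈ tangentHH x) :
    metric6 (projHH x v) w = metric6 v w := by
  simp [metric6, projHH, projHyp, mink_add_left, mink_smul_left, hw.1, hw.2]

lemma complexJ_mem (x v : R6) : complexJ x v ∈ tangentHH x := by
  constructor
  · simp [complexJ, mink_comm x.1, mink_lcross_left]
  · simp [complexJ, mink_comm x.2, mink_lcross_left, mink_neg_left]

/-- An injective linear map into a subspace on which some linear map with target of the same
dimension is injective, is onto that subspace. -/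
lemma mem_range_of_injective {V W E : Type*} [AddCommGroup V] [Module ℝ V]
    [FiniteDimensional ℝ V] [AddCommGroup W] [Module ℝ W] [FiniteDimensional ℝ W]
    [AddCommGroup E] [Module ℝ E] (hVW : Module.finrank ℝ V = Module.finrank ℝ W)
    (D : V →ₗ[ℝ] E) (hD : Function.Injective D) (T : Submodule ℝ E) (hT : ∀ v, D v ∈ T)
    (l : E →ₗ[ℝ] W) (hl : ∀ w ∈ T, l w = 0 → w = 0) {w : E} (hw : w ∈ T) : ∃ v, D v = w := by
  have h1 : Function.Injective (l ∘ₗ D) := by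
    rw [injective_iff_map_eq_zero]
    intro v hv
    exact (injective_iff_map_eq_zero D).1 hD v (hl _ (hT v) hv)
  obtain ⟨v, hv⟩ := (LinearMap.injective_iff_surjective_of_finrank_eq_finrank hVW).1 h1 (l w)
  refine ⟨v, (sub_eq_zero.1 (hl _ (T.sub_mem hw (hT v)) ?_)).symm⟩
  rw [map_sub, ← hv]; simp

/-! ### Second derivatives -/

open Filter Topology Metric

section Calculus

variable {V E F G : Type*} [NormedAddCommGroup V] [NormedSpace ℝ V]
  [NormedAddCommGroup E] [NormedSpace ℝ E] [NormedAddCommGroup F] [NormedSpace ℝ F]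
  [NormedAddCommGroup G] [NormedSpace ℝ G]

/-- The second derivative `∂_u ∂_v f` at `y`. -/
def D2 (f : V → E) (y u v : V) : E := fderiv ℝ (fun z => fderiv ℝ f z v) y u

lemma smooth_differentiableAt {f : V → E} {y : V} (hf : ContDiffAt ℝ ∞ f y) :
    DifferentiableAt ℝ f y := hf.differentiableAt (by simp)

lemma smooth_fderiv {f : V → E} {y : V} (hf : ContDiffAt ℝ ∞ f y) :
    ContDiffAt ℝ ∞ (fderiv ℝ f) y := hf.fderiv_right (by simp)

lemma smooth_fderiv_apply {f : V → E} {y : V} (hf : ContDiffAt ℝ ∞ f y) (v : V) :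
    ContDiffAt ℝ ∞ (fun z => fderiv ℝ f z v) y := (smooth_fderiv hf).clm_apply contDiffAt_const

lemma smooth_eventually {f : V → E} {y : V} (hf : ContDiffAt ℝ ∞ f y) :
    ∀ᶠ z in 𝓝 y, DifferentiableAt ℝ f z := by
  have h1 : ContDiffAt ℝ 1 f y := hf.of_le (by simp)
  filter_upwards [h1.eventually (by simp)] with z hz using hz.differentiableAt (by simp)

lemma fderiv_bilin (B : E →L[ℝ] F →L[ℝ] G) {a : V → E} {b : V → F} {y : V}
    (ha : DifferentiableAt ℝ a y) (hb : DifferentiableAt ℝ b y) (u : V) :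
    fderiv ℝ (fun z => B (a z) (b z)) y u
      = B (fderiv ℝ a y u) (b y) + B (a y) (fderiv ℝ b y u) := by
  rw [(B.hasFDerivAt_of_bilinear ha.hasFDerivAt hb.hasFDerivAt).fderiv]
  simp [add_comm]

lemma D2_eq {f : V → E} {y : V} (hf : ContDiffAt ℝ ∞ f y) (u v : V) :
    D2 f y u v = fderiv ℝ (fderiv ℝ f) y u v := by
  have := fderiv_clm_apply (smooth_differentiableAt (smooth_fderiv hf))
    (differentiableAt_const (c := v))
  unfold D2
  rw [this]
  simp

lemma D2_symm {f : V → E} {y : V} (hf : ContDiffAt ℝ ∞ f y) (u v : V) :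
    D2 f y u v = D2 f y v u := by
  rw [D2_eq hf, D2_eq hf]
  have h2 : (2 : ℕ∞ω) ≤ ∞ := WithTop.coe_le_coe.2 (le_top : (2 : ℕ∞) ≤ ⊤)
  exact hf.isSymmSndFDerivAt (by simpa using h2) u v

lemma fderiv_clm (L : E →L[ℝ] F) {f : V → E} {y : V} (hf : DifferentiableAt ℝ f y) (u : V) :
    fderiv ℝ (fun z => L (f z)) y u = L (fderiv ℝ f y u) :=
  congrArg (· u) (L.hasFDerivAt.comp y hf.hasFDerivAt).fderiv

lemma D2_clm (L : E →L[ℝ] F) {f : V → E} {y : V} (hf : ContDiffAt ℝ ∞ f y) (u v : V) :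
    D2 (fun z => L (f z)) y u v = L (D2 f y u v) := by
  unfold D2
  rw [← fderiv_clm L (smooth_differentiableAt (smooth_fderiv_apply hf v))]
  refine congrArg (fun l : V →L[ℝ] _ => l u) (Filter.EventuallyEq.fderiv_eq ?_)
  filter_upwards [smooth_eventually hf] with z hz using fderiv_clm L hz v

lemma D2_congr {f g : V → E} {y : V} (h : f =ᶠ[𝓝 y] g) (u v : V) :
    D2 f y u v = D2 g y u v := by
  have e : (fun z => fderiv ℝ f z v) =ᶠ[𝓝 y] fun z => fderiv ℝ g z v := by
    filter_upwards [h.fderiv (𝕜 := ℝ)] with z hz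
    rw [hz]
  unfold D2
  rw [e.fderiv_eq]

/-- The second derivative of a composition. -/
lemma D2_comp {f : E → F} {t : V → E} {y : V} (hf : ContDiffAt ℝ ∞ f (t y))
    (ht : ContDiffAt ℝ ∞ t y) (u v : V) :
    D2 (fun z => f (t z)) y u v
      = D2 f (t y) (fderiv ℝ t y u) (fderiv ℝ t y v) + fderiv ℝ f (t y) (D2 t y u v) := by
  have h1 : (fun z => fderiv ℝ (fun z => f (t z)) z v) =ᶠ[𝓝 y]
      fun z => fderiv ℝ f (t z) (fderiv ℝ t z v) := by
    filter_upwards [smooth_eventually ht, ht.continuousAt.eventually (smooth_eventually hf)]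
      with z h1 h2
    exact congrArg (· v) (h2.hasFDerivAt.comp z h1.hasFDerivAt).fderiv
  have h2 : HasFDerivAt (fun z => fderiv ℝ f (t z))
      ((fderiv ℝ (fderiv ℝ f) (t y)).comp (fderiv ℝ t y)) y :=
    (smooth_differentiableAt (smooth_fderiv hf)).hasFDerivAt.comp y
      (smooth_differentiableAt ht).hasFDerivAt
  have h3 := (smooth_differentiableAt (smooth_fderiv_apply ht v)).hasFDerivAt
  rw [D2_eq hf]
  unfold D2
  rw [h1.fderiv_eq, (h2.clm_apply h3).fderiv]
  simp [add_comm]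

/-- A function with second derivative controlled by its 1-jet which vanishes to first order at a
point of a ball vanishes on the ball. -/
lemma eq_zero_of_D2_le {f : V → F} {x₀ : V} {r C : ℝ}
    (hf : ContDiffOn ℝ ∞ f (ball x₀ r))
    (hC : ∀ y ∈ ball x₀ r, ∀ d e,
      ‖D2 f y d e‖ ≤ C * ‖d‖ * ‖e‖ * (‖f y‖ + ‖fderiv ℝ f y‖))
    {y : V} (hy : y ∈ ball x₀ r) (h0 : f y = 0) (h1 : fderiv ℝ f y = 0) {z : V}
    (hz : z ∈ ball x₀ r) : f z = 0 := by
  have hsm : ∀ w ∈ ball x₀ r, ContDiffAt ℝ ∞ f w := fun w hw =>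
    hf.contDiffAt (isOpen_ball.mem_nhds hw)
  set d := z - y with hd
  set c : ℝ → V := fun t => y + t • d with hc
  have hcm : ∀ t ∈ Set.Icc (0 : ℝ) 1, c t ∈ ball x₀ r := by
    intro t ht
    have := (convex_ball x₀ r) hy hz (sub_nonneg.2 ht.2) ht.1 (by ring)
    convert this using 1
    simp only [hc, hd]
    module
  have hcd : ∀ t, HasDerivAt c d t := by
    intro t
    simpa [hc] using ((hasDerivAt_id t).smul_const d).const_add y
  let s : ℝ → F × (V →L[ℝ] F) := fun t => (f (c t), fderiv ℝ f (c t))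
  let s' : ℝ → F × (V →L[ℝ] F) := fun t =>
    (fderiv ℝ f (c t) d, fderiv ℝ (fderiv ℝ f) (c t) d)
  have hs : ∀ t ∈ Set.Icc (0 : ℝ) 1, HasDerivAt s (s' t) t := by
    intro t ht
    have h := hsm _ (hcm t ht)
    exact ((smooth_differentiableAt h).hasFDerivAt.comp_hasDerivAt t (hcd t)).prodMk
      ((smooth_differentiableAt (smooth_fderiv h)).hasFDerivAt.comp_hasDerivAt t (hcd t))
  -- Grönwall for the 1-jet along the segment from `y` to `z`. The components of `s'` are bounded by
  -- `‖d‖ * ‖s‖` and `2 * |C| * ‖d‖ * ‖s‖`; `K` is the sum of the two factors.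
  have key := eq_zero_of_abs_deriv_le_mul_abs_self_of_eq_zero_right (f := s) (f' := s')
    (K := ‖d‖ + 2 * |C| * ‖d‖) (a := 0) (b := 1)
    (fun t ht => (hs t ht).continuousAt.continuousWithinAt)
    (fun t ht => (hs t ⟨ht.1, ht.2.le⟩).hasDerivWithinAt) (by simp [s, hc, h0, h1]) ?_
  · have := congrArg Prod.fst (key 1 (by simp))
    simpa [s, hc, hd] using this
  · intro t ht
    have hm := hcm t ⟨ht.1, ht.2.le⟩
    have hn1 : ‖f (c t)‖ ≤ ‖s t‖ := norm_fst_le (s t)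
    have hn2 : ‖fderiv ℝ f (c t)‖ ≤ ‖s t‖ := norm_snd_le (s t)
    have hd0 := norm_nonneg d
    have hs0 := norm_nonneg (s t)
    refine max_le ?_ ?_
    · calc ‖fderiv ℝ f (c t) d‖ ≤ ‖fderiv ℝ f (c t)‖ * ‖d‖ := ContinuousLinearMap.le_opNorm _ _
        _ ≤ ‖s t‖ * ‖d‖ := by gcongr
        _ ≤ _ := by nlinarith [mul_nonneg (mul_nonneg (abs_nonneg C) hd0) hs0]
    · refine ContinuousLinearMap.opNorm_le_bound _ (by positivity) fun e => ?_
      change ‖fderiv ℝ (fderiv ℝ f) (c t) d e‖ ≤ _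
      rw [← D2_eq (hsm _ hm)]
      calc _ ≤ C * ‖d‖ * ‖e‖ * (‖f (c t)‖ + ‖fderiv ℝ f (c t)‖) := hC _ hm d e
        _ ≤ |C| * ‖d‖ * ‖e‖ * (‖s t‖ + ‖s t‖) := by gcongr; exact le_abs_self C
        _ ≤ _ := by nlinarith [mul_nonneg (mul_nonneg hd0 hs0) (norm_nonneg e)]

/-- An immersion has a smooth field of left inverses of its differential. -/
lemma exists_left_inverse_field [FiniteDimensional ℝ V] {f : V → E} {y : V}
    (hf : ContDiffAt ℝ ∞ f y) (hinj : Function.Injective (fderiv ℝ f y)) [FiniteDimensional ℝ E] :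
    ∃ Q : V → E →L[ℝ] V, ContDiffAt ℝ ∞ Q y ∧ ∀ᶠ z in 𝓝 y, ∀ k, Q z (fderiv ℝ f z k) = k := by
  obtain ⟨l, hl⟩ := LinearMap.exists_leftInverse_of_injective (fderiv ℝ f y : V →ₗ[ℝ] E)
    (LinearMap.ker_eq_bot.2 hinj)
  let lc : E →L[ℝ] V := LinearMap.toContinuousLinearMap l
  -- A left inverse `lc` fixed at `y` makes `m` the identity there, hence invertible nearby; `m⁻¹ ∘
  -- lc` is then a left inverse at nearby points too.
  let m : V → V →L[ℝ] V := fun z => lc.comp (fderiv ℝ f z)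
  have hm : ContDiffAt ℝ ∞ m y := contDiffAt_const.clm_comp (smooth_fderiv hf)
  have hm1 : m y = 1 := by
    ext v; exact congrArg (· v) hl
  have hR : ContDiffAt ℝ ∞ (fun z => Ring.inverse (m z)) y := by
    have : ContDiffAt ℝ ∞ Ring.inverse (m y) := by
      rw [hm1]; exact contDiffAt_ringInverse ℝ (1 : (V →L[ℝ] V)ˣ)
    exact this.comp y hm
  refine ⟨fun z => (Ring.inverse (m z)).comp lc, hR.clm_comp contDiffAt_const, ?_⟩
  have hu : ∀ᶠ z in 𝓝 y, IsUnit (m z) := by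
    have := hm.continuousAt.eventually (Units.isOpen.mem_nhds (by
      rw [hm1]; exact isUnit_one : m y ∈ {x | IsUnit x}))
    exact this
  filter_upwards [hu] with z hz k
  have := congrArg (· k) (Ring.inverse_mul_cancel _ hz)
  exact this

/-- Symmetry of third derivatives for an affine map into the hyperbolic plane: `Γ` are the
Christoffel symbols of a connection for which `φ` is affine. -/
lemma curvature_identity {φ : V → R3} {y : V} {Γ : V → V → V → V}
    (hφ : ContDiffAt ℝ ∞ φ y) (h1 : mink (φ y) (φ y) = -1)
    (ht : ∀ u, mink (φ y) (fderiv ℝ φ y u) = 0)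
    (hΓ : ∀ u v, DifferentiableAt ℝ (fun z => Γ z u v) y)
    (h : ∀ᶠ z in 𝓝 y, ∀ u v, D2 φ z u v =
      fderiv ℝ φ z (Γ z u v) + mink (fderiv ℝ φ z u) (fderiv ℝ φ z v) • φ z) (u v w : V) :
    fderiv ℝ φ y ((Γ y u (Γ y v w) + fderiv ℝ (fun z => Γ z v w) y u
        - (Γ y v (Γ y u w) + fderiv ℝ (fun z => Γ z u w) y v))
      + (mink (fderiv ℝ φ y v) (fderiv ℝ φ y w) • u
        - mink (fderiv ℝ φ y u) (fderiv ℝ φ y w) • v)) = 0 := by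
  have hd : ∀ v, DifferentiableAt ℝ (fun z => fderiv ℝ φ z v) y := fun v =>
    smooth_differentiableAt (smooth_fderiv_apply hφ v)
  have hφd := smooth_differentiableAt hφ
  have hy := h.self_of_nhds
  -- Only the tangential part of the third derivative matters, so its coefficient `c` along the
  -- normal `φ y` is left unspecified.
  have third : ∀ u v, ∃ c : ℝ, D2 (fun z => fderiv ℝ φ z w) y u v =
      fderiv ℝ φ y (Γ y u (Γ y v w) + fderiv ℝ (fun z => Γ z v w) y u
        + mink (fderiv ℝ φ y v) (fderiv ℝ φ y w) • u) + c • φ y := by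
    intro u v
    have e : (fun z => fderiv ℝ (fun z => fderiv ℝ φ z w) z v) =ᶠ[𝓝 y] fun z =>
        fderiv ℝ φ z (Γ z v w) + minkL (fderiv ℝ φ z v) (fderiv ℝ φ z w) • φ z := by
      filter_upwards [h] with z hz using hz v w
    have hm : DifferentiableAt ℝ (fun z => minkL (fderiv ℝ φ z v) (fderiv ℝ φ z w)) y :=
      (minkL.hasFDerivAt_of_bilinear (hd v).hasFDerivAt (hd w).hasFDerivAt).differentiableAt
    have e1 := ((smooth_differentiableAt (smooth_fderiv hφ)).hasFDerivAt.clm_apply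
      (hΓ v w).hasFDerivAt).add (hm.hasFDerivAt.smul hφd.hasFDerivAt)
    have e2 := hy u (Γ y v w)
    rw [D2_eq hφ] at e2
    refine ⟨mink (fderiv ℝ φ y u) (fderiv ℝ φ y (Γ y v w)) +
      fderiv ℝ (fun z => minkL (fderiv ℝ φ z v) (fderiv ℝ φ z w)) y u, ?_⟩
    unfold D2
    rw [e.fderiv_eq]
    refine (congrArg (· u) e1.fderiv).trans ?_
    simp only [add_apply, ContinuousLinearMap.comp_apply,
      ContinuousLinearMap.flip_apply, e2, smul_apply,
      ContinuousLinearMap.smulRight_apply, minkL_apply, map_add, map_smul]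
    module
  obtain ⟨c, hc⟩ := third u v
  obtain ⟨c', hc'⟩ := third v u
  have hs := D2_symm (smooth_fderiv_apply hφ w) u v
  rw [hc, hc'] at hs
  set X := fderiv ℝ φ y ((Γ y u (Γ y v w) + fderiv ℝ (fun z => Γ z v w) y u
        - (Γ y v (Γ y u w) + fderiv ℝ (fun z => Γ z u w) y v))
      + (mink (fderiv ℝ φ y v) (fderiv ℝ φ y w) • u
        - mink (fderiv ℝ φ y u) (fderiv ℝ φ y w) • v)) with hX
  have hXc : X = (c' - c) • φ y := by
    rw [hX]
    simp only [map_add, map_sub, map_smul] at hs ⊢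
    rw [sub_smul, ← sub_eq_zero]
    rw [← sub_eq_zero] at hs
    rw [← hs]
    module
  -- `X` is tangent and also a multiple of the timelike normal `φ y`, so it vanishes.
  have : mink (φ y) X = 0 := ht _
  rw [hXc, mink_smul_right, h1] at this
  rw [hXc, show c' - c = 0 by linarith, zero_smul]

end Calculus

/-! ### Lagrangian surfaces in local coordinates -/

/-- `f` is a Lagrangian immersion of the open set `Ω` of the plane into `ℍ² × ℍ²`. -/
structure LagSurface (f : E2 → R6) (Ω : Set E2) : Prop where
  isOpen : IsOpen Ω
  smooth : ∀ y ∈ Ω, ContDiffAt ℝ ∞ f y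
  mem : ∀ y ∈ Ω, f y ∈ HH
  inj : ∀ y ∈ Ω, Function.Injective (fderiv ℝ f y)
  lagrangian : ∀ y ∈ Ω, ∀ u v, kaehler (f y) (fderiv ℝ f y u) (fderiv ℝ f y v) = 0

/-- The pullback of the metric of the first factor. -/
def pull₁ (f : E2 → R6) (y u v : E2) : ℝ := mink (fderiv ℝ f y u).1 (fderiv ℝ f y v).1

/-- The pullback of the metric of the second factor. -/
def pull₂ (f : E2 → R6) (y u v : E2) : ℝ := mink (fderiv ℝ f y u).2 (fderiv ℝ f y v).2

/-- The first projection `R6 → R3`. -/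
abbrev fstL : R6 →L[ℝ] R3 := ContinuousLinearMap.fst ℝ R3 R3

/-- The second projection `R6 → R3`. -/
abbrev sndL : R6 →L[ℝ] R3 := ContinuousLinearMap.snd ℝ R3 R3

/-! ### Derivatives of maps into the hyperboloid -/

section Hyp

variable {V : Type*} [NormedAddCommGroup V] [NormedSpace ℝ V]

lemma fderiv_mink {a b : V → R3} {y : V} (ha : DifferentiableAt ℝ a y)
    (hb : DifferentiableAt ℝ b y) (u : V) : fderiv ℝ (fun z => mink (a z) (b z)) y u
      = mink (fderiv ℝ a y u) (b y) + mink (a y) (fderiv ℝ b y u) :=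
  fderiv_bilin minkL ha hb u

lemma mink_fderiv_of_sq {φ : V → R3} {y : V} (hφ : DifferentiableAt ℝ φ y)
    (h : ∀ᶠ z in 𝓝 y, mink (φ z) (φ z) = -1) (u : V) : mink (φ y) (fderiv ℝ φ y u) = 0 := by
  have h1 := fderiv_mink hφ hφ u
  have h2 : (fun z => mink (φ z) (φ z)) =ᶠ[𝓝 y] fun _ => -1 := h
  rw [h2.fderiv_eq, mink_comm (fderiv ℝ φ y u)] at h1
  simp at h1
  linarith

lemma mink_D2_of_sq {φ : V → R3} {y : V} (hφ : ContDiffAt ℝ ∞ φ y)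
    (h : ∀ᶠ z in 𝓝 y, mink (φ z) (φ z) = -1) (u v : V) :
    mink (φ y) (D2 φ y u v) = -mink (fderiv ℝ φ y u) (fderiv ℝ φ y v) := by
  have h1 := fderiv_mink (smooth_differentiableAt hφ)
    (smooth_differentiableAt (smooth_fderiv_apply hφ v)) u
  have h2 : (fun z => mink (φ z) (fderiv ℝ φ z v)) =ᶠ[𝓝 y] fun _ => 0 := by
    filter_upwards [h.eventually_nhds, smooth_eventually hφ] with z hz hz'
    exact mink_fderiv_of_sq hz' hz v
  rw [h2.fderiv_eq] at h1
  simp only [fderiv_fun_const, Pi.zero_apply, zero_apply] at h1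
  unfold D2
  linarith

lemma fderiv_mem_tangentHH {g : V → R6} {y : V} (hg : DifferentiableAt ℝ g y)
    (h : ∀ᶠ z in 𝓝 y, g z ∈ HH) (u : V) : fderiv ℝ g y u ∈ tangentHH (g y) := by
  have h1 : fderiv ℝ (fun z => (g z).1) y u = (fderiv ℝ g y u).1 := fderiv_clm fstL hg u
  have h2 : fderiv ℝ (fun z => (g z).2) y u = (fderiv ℝ g y u).2 := fderiv_clm sndL hg u
  constructor
  · rw [← h1]
    exact mink_fderiv_of_sq hg.fst (h.mono fun z hz => HH.sq_fst hz) u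
  · rw [← h2]
    exact mink_fderiv_of_sq hg.snd (h.mono fun z hz => HH.sq_snd hz) u

end Hyp

/-- Three vectors in the plane orthogonal to `x` are dependent; `smul_triple` expresses this as the
triple product annihilating `x`. -/
lemma mink_lcross_tangent {x a b c : R3} (hx : mink x x = -1) (ha : mink x a = 0)
    (hb : mink x b = 0) (hc : mink x c = 0) : mink (lcross a b) c = 0 := by
  have h := smul_triple a b c x
  rw [ha, hb, hc] at h
  simp only [zero_smul, add_zero] at h
  have : mink (mink (lcross a b) c • x) x = 0 := by rw [h]; simp
  rw [mink_smul_left, hx] at this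
  linarith

lemma kaehler_eq (x v w : R6) :
    kaehler x v w = mink (lcross x.1 v.1) w.1 - mink (lcross x.2 v.2) w.2 := by
  simp [kaehler, metric6, complexJ, mink_neg_left, sub_eq_add_neg]

namespace LagSurface

variable {f : E2 → R6} {Ω : Set E2} (hf : LagSurface f Ω) {y : E2} (hy : y ∈ Ω)
include hf hy

lemma eventually_mem : ∀ᶠ z in 𝓝 y, z ∈ Ω := hf.isOpen.mem_nhds hy

lemma smooth_fst : ContDiffAt ℝ ∞ (fun z => (f z).1) y := (hf.smooth y hy).fst

lemma smooth_snd : ContDiffAt ℝ ∞ (fun z => (f z).2) y := (hf.smooth y hy).snd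

lemma fderiv_fst (u : E2) : fderiv ℝ (fun z => (f z).1) y u = (fderiv ℝ f y u).1 :=
  fderiv_clm fstL (smooth_differentiableAt (hf.smooth y hy)) u

lemma fderiv_snd (u : E2) : fderiv ℝ (fun z => (f z).2) y u = (fderiv ℝ f y u).2 :=
  fderiv_clm sndL (smooth_differentiableAt (hf.smooth y hy)) u

lemma D2_fst (u v : E2) : D2 (fun z => (f z).1) y u v = (D2 f y u v).1 :=
  D2_clm fstL (hf.smooth y hy) u v

lemma D2_snd (u v : E2) : D2 (fun z => (f z).2) y u v = (D2 f y u v).2 :=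
  D2_clm sndL (hf.smooth y hy) u v

lemma sq_fst : mink (f y).1 (f y).1 = -1 := HH.sq_fst (hf.mem y hy)

lemma sq_snd : mink (f y).2 (f y).2 = -1 := HH.sq_snd (hf.mem y hy)

lemma eventually_sq_fst : ∀ᶠ z in 𝓝 y, mink (f z).1 (f z).1 = -1 := by
  filter_upwards [hf.eventually_mem hy] with z hz using hf.sq_fst hz

lemma eventually_sq_snd : ∀ᶠ z in 𝓝 y, mink (f z).2 (f z).2 = -1 := by
  filter_upwards [hf.eventually_mem hy] with z hz using hf.sq_snd hz

lemma tangent (u : E2) : fderiv ℝ f y u ∈ tangentHH (f y) :=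
  fderiv_mem_tangentHH (smooth_differentiableAt (hf.smooth y hy))
    ((hf.eventually_mem hy).mono fun z hz => hf.mem z hz) u

lemma projHH_D2 (u v : E2) : projHH (f y) (D2 f y u v) =
    D2 f y u v - (pull₁ f y u v • (f y).1, pull₂ f y u v • (f y).2) := by
  have h1 := mink_D2_of_sq (hf.smooth_fst hy) (hf.eventually_sq_fst hy) u v
  have h2 := mink_D2_of_sq (hf.smooth_snd hy) (hf.eventually_sq_snd hy) u v
  rw [hf.D2_fst hy, hf.fderiv_fst hy, hf.fderiv_fst hy] at h1
  rw [hf.D2_snd hy, hf.fderiv_snd hy, hf.fderiv_snd hy] at h2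
  apply Prod.ext
  · simp only [projHH, projHyp, h1, pull₁, Prod.fst_sub, neg_smul, ← sub_eq_add_neg]
  · simp only [projHH, projHyp, h2, pull₂, Prod.snd_sub, neg_smul, ← sub_eq_add_neg]

/-- The cubic form of a Lagrangian surface is symmetric. -/
lemma cubic_symm (u v w : E2) :
    metric6 (D2 f y u v) (complexJ (f y) (fderiv ℝ f y w))
      = metric6 (D2 f y u w) (complexJ (f y) (fderiv ℝ f y v)) := by
  -- The derivative of a pulled-back area form has only second derivative terms: differentiating the
  -- base point yields a triple product of three tangent vectors. Subtracting the two factors then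
  -- differentiates the Lagrangian condition.
  have key : ∀ {φ : E2 → R3}, ContDiffAt ℝ ∞ φ y → (∀ᶠ z in 𝓝 y, mink (φ z) (φ z) = -1) →
      HasFDerivAt (fun z => mink (lcross (φ z) (fderiv ℝ φ z v)) (fderiv ℝ φ z w))
        (fderiv ℝ (fun z => mink (lcross (φ z) (fderiv ℝ φ z v)) (fderiv ℝ φ z w)) y) y ∧
      fderiv ℝ (fun z => mink (lcross (φ z) (fderiv ℝ φ z v)) (fderiv ℝ φ z w)) y u
        = mink (lcross (φ y) (fderiv ℝ φ y v)) (D2 φ y u w)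
          - mink (lcross (φ y) (fderiv ℝ φ y w)) (D2 φ y u v) := by
    intro φ hφ h1
    have d0 := smooth_differentiableAt hφ
    have dv := smooth_differentiableAt (smooth_fderiv_apply hφ v)
    have dw := smooth_differentiableAt (smooth_fderiv_apply hφ w)
    have dc : DifferentiableAt ℝ (fun z => lcross (φ z) (fderiv ℝ φ z v)) y :=
      (lcrossL.hasFDerivAt_of_bilinear d0.hasFDerivAt dv.hasFDerivAt).differentiableAt
    refine ⟨(minkL.hasFDerivAt_of_bilinear dc.hasFDerivAt
      dw.hasFDerivAt).differentiableAt.hasFDerivAt, ?_⟩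
    rw [fderiv_mink dc dw]
    have e : fderiv ℝ (fun z => lcross (φ z) (fderiv ℝ φ z v)) y u = _ :=
      fderiv_bilin lcrossL d0 dv u
    rw [e]
    have ht := mink_fderiv_of_sq d0 h1
    simp only [lcrossL_apply, mink_add_left]
    rw [mink_lcross_tangent h1.self_of_nhds (ht u) (ht v) (ht w),
      mink_lcross_swap (φ y) (fderiv ℝ (fun z => fderiv ℝ φ z v) y u)]
    unfold D2
    ring
  obtain ⟨a1, b1⟩ := key (hf.smooth_fst hy) (hf.eventually_sq_fst hy)
  obtain ⟨a2, b2⟩ := key (hf.smooth_snd hy) (hf.eventually_sq_snd hy)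
  have h0 : (fun z => mink (lcross (f z).1 (fderiv ℝ (fun z => (f z).1) z v))
        (fderiv ℝ (fun z => (f z).1) z w)
      - mink (lcross (f z).2 (fderiv ℝ (fun z => (f z).2) z v))
        (fderiv ℝ (fun z => (f z).2) z w)) =ᶠ[𝓝 y] fun _ => 0 := by
    filter_upwards [hf.eventually_mem hy] with z hz
    rw [hf.fderiv_fst hz, hf.fderiv_fst hz, hf.fderiv_snd hz, hf.fderiv_snd hz, ← kaehler_eq]
    exact hf.lagrangian z hz v w
  have h1 := congrArg (fun l : E2 →L[ℝ] ℝ => l u) ((a1.sub a2).fderiv.symm.trans h0.fderiv_eq)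
  simp only [fderiv_fun_const, Pi.zero_apply, zero_apply, sub_apply, b1, b2] at h1
  simp only [hf.fderiv_fst hy, hf.fderiv_snd hy, hf.D2_fst hy, hf.D2_snd hy] at h1
  simp only [metric6, complexJ, mink_neg_right]
  rw [mink_comm _ (lcross _ _), mink_comm _ (lcross _ _), mink_comm _ (lcross _ _),
    mink_comm _ (lcross _ _)]
  linarith

end LagSurface

/-! ### Charts -/

section Charts

variable {M : Type*} [TopologicalSpace M] [ChartedSpace E2 M]

/-- `Φ` in the preferred chart at `p`. -/
def localRep (Φ : M → R6) (p : M) : E2 → R6 := fun z => Φ ((chartAt E2 p).symm z)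

lemma localRep_self (Φ : M → R6) (p : M) : localRep Φ p (chartAt E2 p p) = Φ p := by
  simp [localRep, (chartAt E2 p).left_inv (mem_chart_source E2 p)]

lemma hess_eq (Φ : M → R6) (p : M) (u v : E2) :
    hess Φ p u v = D2 (localRep Φ p) (chartAt E2 p p) u v := rfl

lemma diff_eq {Φ : M → R6} (hΦ : ContMDiff 𝓘(ℝ, E2) 𝓘(ℝ, R6) ∞ Φ) (p : M) :
    diff Φ p = fderiv ℝ (localRep Φ p) (chartAt E2 p p) := by
  have h : MDifferentiableAt 𝓘(ℝ, E2) 𝓘(ℝ, R6) Φ p := hΦ.mdifferentiableAt (by simp)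
  have e : fderivWithin ℝ (writtenInExtChartAt 𝓘(ℝ, E2) 𝓘(ℝ, R6) p Φ) (Set.range 𝓘(ℝ, E2))
      (extChartAt 𝓘(ℝ, E2) p p) = fderiv ℝ (localRep Φ p) (chartAt E2 p p) := by
    simp only [writtenInExtChartAt, Function.comp_def, mfld_simps, fderivWithin_univ]
    rfl
  exact h.mfderiv.trans e

variable [IsManifold 𝓘(ℝ, E2) ∞ M]

lemma localRep_smooth {Φ : M → R6} (hΦ : ContMDiff 𝓘(ℝ, E2) 𝓘(ℝ, R6) ∞ Φ) (p : M) {y : E2}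
    (hy : y ∈ (chartAt E2 p).target) :
    ContDiffAt ℝ ∞ (localRep Φ p) y := by
  rw [← contMDiffAt_iff_contDiffAt]
  exact hΦ.contMDiffAt.comp y ((contMDiffOn_chart_symm (I := 𝓘(ℝ, E2)) (x := p)).contMDiffAt
    ((chartAt E2 p).open_target.mem_nhds hy))

/-- Change of charts for the first and second derivatives. -/
lemma chart_transition {Φ : M → R6} (hΦ : ContMDiff 𝓘(ℝ, E2) 𝓘(ℝ, R6) ∞ Φ) (p q : M)
    (hq : q ∈ (chartAt E2 p).source) :
    ∃ (T : E2 ≃L[ℝ] E2) (S : E2 → E2 → E2),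
      (∀ u, fderiv ℝ (localRep Φ p) (chartAt E2 p q) u = diff Φ q (T u)) ∧
      ∀ u v, D2 (localRep Φ p) (chartAt E2 p q) u v
        = hess Φ q (T u) (T v) + diff Φ q (S u v) := by
  set y := chartAt E2 p q with hy
  have hyt : y ∈ (chartAt E2 p).target := (chartAt E2 p).map_source hq
  have hys : (chartAt E2 p).symm y = q := (chartAt E2 p).left_inv hq
  let t : E2 → E2 := fun z => chartAt E2 q ((chartAt E2 p).symm z)
  let t' : E2 → E2 := fun z => chartAt E2 p ((chartAt E2 q).symm z)
  have hty : t y = chartAt E2 q q := by simp [t, hys]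
  have smooth : ∀ (a b : M) (z : E2), z ∈ (chartAt E2 a).target →
      (chartAt E2 a).symm z ∈ (chartAt E2 b).source →
      ContDiffAt ℝ ∞ (fun z => chartAt E2 b ((chartAt E2 a).symm z)) z := by
    intro a b z hz hz'
    rw [← contMDiffAt_iff_contDiffAt]
    exact ((contMDiffOn_chart (I := 𝓘(ℝ, E2)) (x := b)).contMDiffAt
      ((chartAt E2 b).open_source.mem_nhds hz')).comp z
      ((contMDiffOn_chart_symm (I := 𝓘(ℝ, E2)) (x := a)).contMDiffAt
        ((chartAt E2 a).open_target.mem_nhds hz))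
  have hts : ContDiffAt ℝ ∞ t y := smooth p q y hyt (by rw [hys]; exact mem_chart_source E2 q)
  have hts' : ContDiffAt ℝ ∞ t' (t y) := by
    rw [hty]
    refine smooth q p _ (mem_chart_target E2 q) ?_
    rwa [(chartAt E2 q).left_inv (mem_chart_source E2 q)]
  have hev : ∀ᶠ z in 𝓝 y, z ∈ (chartAt E2 p).target ∧
      (chartAt E2 p).symm z ∈ (chartAt E2 q).source := by
    refine Filter.Eventually.and ((chartAt E2 p).open_target.mem_nhds hyt) ?_
    refine ((chartAt E2 p).symm.continuousAt hyt).eventually ?_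
    rw [hys]
    exact (chartAt E2 q).open_source.mem_nhds (mem_chart_source E2 q)
  have hid : (fun z => t' (t z)) =ᶠ[𝓝 y] id := by
    filter_upwards [hev] with z hz
    simp only [t, t', (chartAt E2 q).left_inv hz.2, (chartAt E2 p).right_inv hz.1, id]
  have hcomp : localRep Φ p =ᶠ[𝓝 y] fun z => localRep Φ q (t z) := by
    filter_upwards [hev] with z hz
    simp only [localRep, t, (chartAt E2 q).left_inv hz.2]
  -- The inverse transition `t'` serves only to make the differential of `t` injective, hence an
  -- isomorphism.
  have hinj : Function.Injective (fderiv ℝ t y) := by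
    have h1 := ((smooth_differentiableAt hts').hasFDerivAt.comp y
      (smooth_differentiableAt hts).hasFDerivAt).fderiv
    have h2 := h1.symm.trans hid.fderiv_eq
    intro u v huv
    have h3 := congrArg (fun l : E2 →L[ℝ] E2 => l u) h2
    have h4 := congrArg (fun l : E2 →L[ℝ] E2 => l v) h2
    simp only [ContinuousLinearMap.comp_apply, fderiv_id, ContinuousLinearMap.id_apply] at h3 h4
    rw [← h3, ← h4, huv]
  have hrep : ContDiffAt ℝ ∞ (localRep Φ q) (t y) := by
    rw [hty]; exact localRep_smooth hΦ q (mem_chart_target E2 q)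
  let T : E2 ≃L[ℝ] E2 :=
    (LinearEquiv.ofInjectiveEndo (fderiv ℝ t y : E2 →ₗ[ℝ] E2) hinj).toContinuousLinearEquiv
  have hT : ∀ u, T u = fderiv ℝ t y u := fun u => rfl
  -- The second derivative of the transition map enters only through `diff Φ q`, so it changes the
  -- second derivative of `Φ` by a tangent vector.
  refine ⟨T, fun u v => D2 t y u v, fun u => ?_, fun u v => ?_⟩
  · rw [hcomp.fderiv_eq, hT, diff_eq hΦ q, ← hty]
    exact congrArg (· u) ((smooth_differentiableAt hrep).hasFDerivAt.comp y
      (smooth_differentiableAt hts).hasFDerivAt).fderiv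
  · rw [D2_congr hcomp, D2_comp hrep hts, hess_eq, diff_eq hΦ q, hty, hT, hT]

lemma localRep_lagSurface {Φ : M → R6} (hΦ : IsImmersionHH Φ) (hL : IsLagrangian Φ) (p : M) :
    LagSurface (localRep Φ p) (chartAt E2 p).target := by
  have hmem : ∀ y ∈ (chartAt E2 p).target, ∃ q ∈ (chartAt E2 p).source,
      chartAt E2 p q = y ∧ localRep Φ p y = Φ q := fun y hy =>
    ⟨(chartAt E2 p).symm y, (chartAt E2 p).map_target hy, (chartAt E2 p).right_inv hy, rfl⟩
  refine ⟨(chartAt E2 p).open_target, fun y hy => localRep_smooth hΦ.smooth p hy,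
    fun y _ => hΦ.mem _, fun y hy => ?_, fun y hy u v => ?_⟩
  · obtain ⟨q, hq, rfl, -⟩ := hmem y hy
    obtain ⟨T, S, h1, -⟩ := chart_transition hΦ.smooth p q hq
    intro u v huv
    rw [h1, h1] at huv
    exact T.injective (hΦ.injective q huv)
  · obtain ⟨q, hq, rfl, h⟩ := hmem y hy
    obtain ⟨T, S, h1, -⟩ := chart_transition hΦ.smooth p q hq
    rw [h1, h1, h]
    exact hL q _ _

end Charts

/-! ### The second fundamental form -/

section Surface

variable {M : Type*} [TopologicalSpace M] [ChartedSpace E2 M]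

lemma diff_eq_frame (Φ : M → R6) (p : M) (u : E2) : diff Φ p u = ∑ i, u i • frame Φ p i := by
  conv_lhs => rw [← (EuclideanSpace.basisFun (Fin 2) ℝ).sum_repr u]
  simp [frame]

lemma tangentPart_mem_range (Φ : M → R6) (p : M) (w : R6) :
    ∃ k, diff Φ p k = tangentPart Φ p w := by
  refine ⟨∑ i, ∑ j, ((gram Φ p)⁻¹ i j * metric6 w (frame Φ p i)) • EuclideanSpace.single j 1, ?_⟩
  simp only [map_sum, map_smul]
  rfl

lemma IsTotallyGeodesic.isTotallyUmbilical {Φ : M → R6} (hG : IsTotallyGeodesic Φ) :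
    IsTotallyUmbilical Φ := fun p => ⟨0, fun u v => by rw [hG p u v, smul_zero]⟩

variable [IsManifold 𝓘(ℝ, E2) ∞ M] {Φ : M → R6} (hΦ : IsImmersionHH Φ)
include hΦ

lemma diff_tangent (p : M) (u : E2) : diff Φ p u ∈ tangentHH (Φ p) := by
  have h := fderiv_mem_tangentHH
    (smooth_differentiableAt (localRep_smooth hΦ.smooth p (mem_chart_target E2 p)))
    (Eventually.of_forall fun z => hΦ.mem _) u
  rwa [localRep_self, ← diff_eq hΦ.smooth] at h

lemma inducedMetric_self_eq_zero (p : M) {u : E2} (h : inducedMetric Φ p u u = 0) : u = 0 := by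
  have := eq_zero_of_metric6_self (hΦ.mem p) (diff_tangent hΦ p u) h
  exact (injective_iff_map_eq_zero _).1 (hΦ.injective p) u this

lemma gram_isUnit (p : M) : IsUnit (gram Φ p).det := by
  rw [isUnit_iff_ne_zero]
  intro h
  obtain ⟨v, hv, hv'⟩ := Matrix.exists_mulVec_eq_zero_iff.2 h
  let k : E2 := WithLp.toLp 2 v
  have hk : inducedMetric Φ p k k = 0 := by
    unfold inducedMetric
    rw [diff_eq_frame]
    have h0 := congrFun hv' 0
    have h1 := congrFun hv' 1
    simp only [Matrix.mulVec, dotProduct, Fin.sum_univ_two, gram, Matrix.of_apply,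
      Pi.zero_apply] at h0 h1
    simp only [Fin.sum_univ_two, metric6_add_left, metric6_add_right, metric6_smul_left,
      metric6_smul_right, k]
    linear_combination v 0 * h0 + v 1 * h1
  apply hv
  have := inducedMetric_self_eq_zero hΦ p hk
  simpa [k] using this

lemma metric6_tangentPart (p : M) (w : R6) (u : E2) :
    metric6 (tangentPart Φ p w) (diff Φ p u) = metric6 w (diff Φ p u) := by
  have key : ∀ k, metric6 (tangentPart Φ p w) (frame Φ p k) = metric6 w (frame Φ p k) := by
    intro k
    have h := Matrix.nonsing_inv_mul _ (gram_isUnit hΦ p)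
    have h0 := congrFun (congrFun h 0) k
    have h1 := congrFun (congrFun h 1) k
    simp only [Matrix.mul_apply, Fin.sum_univ_two] at h0 h1
    rw [show gram Φ p 0 k = metric6 (frame Φ p 0) (frame Φ p k) from rfl,
      show gram Φ p 1 k = metric6 (frame Φ p 1) (frame Φ p k) from rfl] at h0 h1
    simp only [tangentPart, Fin.sum_univ_two, metric6_add_left, metric6_smul_left]
    have h2 : metric6 w (frame Φ p k) = (1 : Matrix (Fin 2) (Fin 2) ℝ) 0 k *
        metric6 w (frame Φ p 0) + (1 : Matrix (Fin 2) (Fin 2) ℝ) 1 k *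
        metric6 w (frame Φ p 1) := by
      rcases (by omega : k = 0 ∨ k = 1) with rfl | rfl <;> simp
    rw [h2, ← h0, ← h1]
    ring
  rw [diff_eq_frame]
  simp only [Fin.sum_univ_two, metric6_add_right, metric6_smul_right, key]

lemma sff_tangent (p : M) (u v : E2) : sff Φ p u v ∈ tangentHH (Φ p) := by
  obtain ⟨k, hk⟩ := tangentPart_mem_range Φ p (projHH (Φ p) (hess Φ p u v))
  unfold sff
  rw [← hk]
  exact (tangentSub (Φ p)).sub_mem (projHH_mem (hΦ.mem p) _) (diff_tangent hΦ p k)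

/-- If the covariant derivative is tangent to the surface, then `sff` is both tangent and normal,
hence zero by definiteness. This removes the inverse Gram matrix from the condition. -/
lemma sff_eq_zero_iff (p : M) (u v : E2) :
    sff Φ p u v = 0 ↔ ∃ k, diff Φ p k = projHH (Φ p) (hess Φ p u v) := by
  obtain ⟨k, hk⟩ := tangentPart_mem_range Φ p (projHH (Φ p) (hess Φ p u v))
  constructor
  · intro h
    exact ⟨k, hk.trans (sub_eq_zero.1 h).symm⟩
  · rintro ⟨l, hl⟩
    have h0 : metric6 (sff Φ p u v) (diff Φ p (l - k)) = 0 := by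
      unfold sff
      rw [metric6_sub_left, metric6_tangentPart hΦ, sub_self]
    have h1 : sff Φ p u v = diff Φ p (l - k) := by
      rw [map_sub, hl, hk]; rfl
    rw [← h1] at h0
    exact eq_zero_of_metric6_self (hΦ.mem p) (sff_tangent hΦ p u v) h0

/-- Total geodesy in terms of a chart. -/
lemma IsTotallyGeodesic.localRep (hG : IsTotallyGeodesic Φ) (p : M) {y : E2}
    (hy : y ∈ (chartAt E2 p).target) (u v : E2) :
    ∃ k, fderiv ℝ (localRep Φ p) y k
      = projHH (localRep Φ p y) (D2 (localRep Φ p) y u v) := by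
  set q := (chartAt E2 p).symm y with hq
  have hqs : q ∈ (chartAt E2 p).source := (chartAt E2 p).map_target hy
  have hqy : chartAt E2 p q = y := (chartAt E2 p).right_inv hy
  obtain ⟨T, S, h1, h2⟩ := chart_transition hΦ.smooth p q hqs
  rw [hqy] at h1 h2
  obtain ⟨k, hk⟩ := (sff_eq_zero_iff hΦ q (T u) (T v)).1 (hG q (T u) (T v))
  refine ⟨T.symm (k + S u v), ?_⟩
  rw [h1, T.apply_symm_apply, map_add, hk, h2, show LagHH.localRep Φ p y = Φ q from rfl]
  have ht := diff_tangent hΦ q (S u v)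
  apply Prod.ext
  · simp only [projHH, projHyp, Prod.fst_add, mink_add_right, ht.1]
    module
  · simp only [projHH, projHyp, Prod.snd_add, mink_add_right, ht.2]
    module

/-- By the Lagrangian condition `diff Φ p` and its image under J have orthogonal ranges, so together
they embed `E2 × E2` in the four-dimensional tangent space and fill it. A tangent vector orthogonal
to both is orthogonal to itself. -/
lemma normal_eq_zero (hL : IsLagrangian Φ) (p : M) {w : R6} (hw : w ∈ tangentHH (Φ p))
    (h1 : ∀ u, metric6 w (diff Φ p u) = 0)
    (h2 : ∀ u, metric6 w (complexJ (Φ p) (diff Φ p u)) = 0) : w = 0 := by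
  let J : R6 →ₗ[ℝ] R6 :=
    ((lcrossL (Φ p).1).comp fstL).prod (-((lcrossL (Φ p).2).comp sndL))
  have hJ : ∀ v, J v = complexJ (Φ p) v := fun v => rfl
  have hJJ : ∀ a b, b ∈ tangentHH (Φ p) →
      metric6 (complexJ (Φ p) a) (complexJ (Φ p) b) = metric6 a b := by
    intro a b hb
    simp only [metric6, complexJ, mink_neg_left, mink_neg_right, mink_lcross_lcross,
      HH.sq_fst (hΦ.mem p), HH.sq_snd (hΦ.mem p), hb.1, hb.2]
    ring
  let D : E2 × E2 →ₗ[ℝ] R6 := LinearMap.coprod (diff Φ p : E2 →ₗ[ℝ] R6)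
    (J ∘ₗ (diff Φ p : E2 →ₗ[ℝ] R6))
  have hD : ∀ a, D a = diff Φ p a.1 + complexJ (Φ p) (diff Φ p a.2) := fun a => rfl
  have hDT : ∀ a, D a ∈ tangentSub (Φ p) := fun a => by
    rw [hD]
    exact (tangentSub (Φ p)).add_mem (diff_tangent hΦ p _) (complexJ_mem _ _)
  have hDinj : Function.Injective D := by
    rw [injective_iff_map_eq_zero]
    rintro ⟨a, b⟩ hab
    rw [hD] at hab
    have e1 : metric6 (diff Φ p a + complexJ (Φ p) (diff Φ p b)) (diff Φ p a) = 0 := by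
      rw [hab]; simp
    have e2 : metric6 (diff Φ p a + complexJ (Φ p) (diff Φ p b))
        (complexJ (Φ p) (diff Φ p b)) = 0 := by
      rw [hab]; simp
    have hk : metric6 (complexJ (Φ p) (diff Φ p b)) (diff Φ p a) = 0 := hL p b a
    rw [metric6_add_left, hk, add_zero] at e1
    rw [metric6_add_left, metric6_comm, hk, zero_add,
      hJJ _ _ (diff_tangent hΦ p b)] at e2
    rw [inducedMetric_self_eq_zero hΦ p e1, inducedMetric_self_eq_zero hΦ p e2]
    rfl
  let l : R6 →ₗ[ℝ] ((ℝ × ℝ) × (ℝ × ℝ)) :=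
    { toFun := fun v => ((v.1 1, v.1 2), (v.2 1, v.2 2))
      map_add' := fun _ _ => rfl
      map_smul' := fun _ _ => rfl }
  have hl : ∀ v ∈ tangentSub (Φ p), l v = 0 → v = 0 := by
    intro v hv hv0
    simp only [l, LinearMap.coe_mk, AddHom.coe_mk, Prod.mk_eq_zero] at hv0
    exact Prod.ext (eq_zero_of_coords (HH.sq_fst (hΦ.mem p)) hv.1 hv0.1.1 hv0.1.2)
      (eq_zero_of_coords (HH.sq_snd (hΦ.mem p)) hv.2 hv0.2.1 hv0.2.2)
  obtain ⟨a, ha⟩ := mem_range_of_injective (by simp) D hDinj (tangentSub (Φ p)) hDT l hl hw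
  refine eq_zero_of_metric6_self (hΦ.mem p) hw ?_
  nth_rw 2 [← ha]
  rw [hD, metric6_add_right, h1, h2, add_zero]

/-- A totally umbilical Lagrangian surface is totally geodesic. -/
lemma IsTotallyUmbilical.isTotallyGeodesic (hL : IsLagrangian Φ) (hU : IsTotallyUmbilical Φ) :
    IsTotallyGeodesic Φ := by
  intro p u v
  obtain ⟨H, hH⟩ := hU p
  have hf := localRep_lagSurface hΦ hL p
  -- Paired with J of a tangent vector, `sff` may be replaced by the raw second derivative: the
  -- tangential part drops out by the Lagrangian condition.
  have hC : ∀ a b c, metric6 (sff Φ p a b) (complexJ (Φ p) (diff Φ p c))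
      = metric6 (hess Φ p a b) (complexJ (Φ p) (diff Φ p c)) := by
    intro a b c
    obtain ⟨k, hk⟩ := tangentPart_mem_range Φ p (projHH (Φ p) (hess Φ p a b))
    have hk0 : metric6 (complexJ (Φ p) (diff Φ p c)) (diff Φ p k) = 0 := hL p c k
    unfold sff
    rw [metric6_sub_left, metric6_projHH _ (complexJ_mem _ _), ← hk,
      metric6_comm (diff Φ p k), hk0, sub_zero]
  have hS : ∀ a b c, metric6 (sff Φ p a b) (complexJ (Φ p) (diff Φ p c))
      = metric6 (sff Φ p a c) (complexJ (Φ p) (diff Φ p b)) := by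
    intro a b c
    rw [hC, hC]
    have := hf.cubic_symm (mem_chart_target E2 p) a b c
    rwa [localRep_self, ← diff_eq hΦ.smooth] at this
  -- Choose `a ≠ 0` orthogonal to `c` and compare the cubic form at `(a, a, c)` and `(a, c, a)`.
  have hη : ∀ c, metric6 H (complexJ (Φ p) (diff Φ p c)) = 0 := by
    intro c
    obtain ⟨a, ha, hac⟩ : ∃ a : E2, a ≠ 0 ∧ inducedMetric Φ p a c = 0 := by
      let m : E2 →ₗ[ℝ] ℝ := ((metricL (diff Φ p c)).comp (diff Φ p) : E2 →L[ℝ] ℝ)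
      have : ¬ Function.Injective m := by
        intro hm
        have := LinearMap.finrank_le_finrank_of_injective hm
        simp at this
      rw [injective_iff_map_eq_zero] at this
      push Not at this
      obtain ⟨a, h1, h2⟩ := this
      exact ⟨a, h2, (metric6_comm _ _).trans h1⟩
    have h := hS a a c
    rw [hH, hH, metric6_smul_left, metric6_smul_left, hac, zero_mul] at h
    rcases mul_eq_zero.1 h with h | h
    · exact absurd (inducedMetric_self_eq_zero hΦ p h) ha
    · exact h
  refine normal_eq_zero hΦ hL p (sff_tangent hΦ p u v) (fun a => ?_) (fun a => ?_)
  · unfold sff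
    rw [metric6_sub_left, metric6_tangentPart hΦ, sub_self]
  · rw [hH, metric6_smul_left, hη, mul_zero]

end Surface

/-! ### Totally geodesic surfaces in local coordinates -/

/-- `f` is a totally geodesic Lagrangian immersion of the open set `Ω` into `ℍ² × ℍ²`. -/
structure GeodesicSurface (f : E2 → R6) (Ω : Set E2) : Prop extends LagSurface f Ω where
  geodesic : ∀ y ∈ Ω, ∀ u v, ∃ k, fderiv ℝ f y k = projHH (f y) (D2 f y u v)

/-- The coordinate vectors of the plane. -/
abbrev basisVec (i : Fin 2) : E2 := EuclideanSpace.single i 1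

lemma eq_sum_basisVec (u : E2) : u = u 0 • basisVec 0 + u 1 • basisVec 1 := by
  ext i; fin_cases i <;> simp [basisVec]

/-- A linear map from the plane to a tangent plane of `ℍ²` is injective if and only if its
determinant is nonzero. -/
lemma injective_iff_triple {x : R3} {D : E2 →ₗ[ℝ] R3} (hx : mink x x = -1)
    (hD : ∀ u, mink x (D u) = 0) : (∀ u, D u = 0 → u = 0) ↔
      mink (lcross x (D (basisVec 0))) (D (basisVec 1)) ≠ 0 := by
  set a := D (basisVec 0) with ha
  set b := D (basisVec 1) with hb
  constructor
  · intro h h0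
    -- A vanishing determinant is the equality case of Cauchy–Schwarz, so this Gram–Schmidt
    -- combination has length zero. Injectivity then kills its coefficient `mink a a` of `basisVec
    -- 1`, hence `a` itself.
    have hz : mink a a • b - mink a b • a = 0 := by
      refine eq_zero_of_mink_self hx ?_ ?_
      · simp [mink_sub_right, mink_smul_right, ha, hb, hD]
      · have h1 := mink_lcross_lcross (lcross x a) b (lcross x a) b
        have h2 : lcross (lcross x a) b = mink a b • x := by
          rw [lcross_neg_comm, lcross_lcross, mink_comm b x, show mink x b = 0 from hD _,
            mink_comm b a]
          module
        rw [h2, h0, mink_smul_left, mink_smul_right, hx, mink_lcross_lcross, hx,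
          show mink x a = 0 from hD _] at h1
        simp only [mink_sub_left, mink_sub_right, mink_smul_left, mink_smul_right, mink_comm b a]
        linear_combination mink a a * h1
    rw [ha, hb, ← map_smul, ← map_smul, ← map_sub] at hz
    have h3 := congrArg (fun w : E2 => w 1) (h _ hz)
    rw [← ha] at h3
    simp [basisVec] at h3
    have h4 := h _ (ha ▸ eq_zero_of_mink_self hx (hD _) h3)
    simpa [basisVec] using congrArg (fun w : E2 => w 0) h4
  · intro h u hu
    have e : D u = u 0 • a + u 1 • b := by
      conv_lhs => rw [eq_sum_basisVec u]
      simp [ha, hb]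
    rw [hu] at e
    have h0 : mink (lcross x (u 0 • a + u 1 • b)) b = 0 := by
      rw [← e, mink_lcross_swap]; simp
    have h1 : mink (lcross x a) (u 0 • a + u 1 • b) = 0 := by
      rw [← e]; simp
    rw [lcross_add_right, lcross_smul_right, lcross_smul_right, mink_add_left, mink_smul_left,
      mink_smul_left, mink_lcross_right, mul_zero, add_zero] at h0
    rw [mink_add_right, mink_smul_right, mink_smul_right, mink_lcross_right, mul_zero,
      zero_add] at h1
    rw [eq_sum_basisVec u, (mul_eq_zero.1 h0).resolve_right h,
      (mul_eq_zero.1 h1).resolve_right h]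
    simp

lemma norm_projHH_le (x w : R6) : ‖projHH x w‖ ≤ (1 + ‖minkL‖ * ‖x‖ * ‖x‖) * ‖w‖ := by
  have key : ∀ a b : R3, ‖a‖ ≤ ‖x‖ → ‖b‖ ≤ ‖w‖ →
      ‖projHyp a b‖ ≤ (1 + ‖minkL‖ * ‖x‖ * ‖x‖) * ‖w‖ := by
    intro a b ha hb
    have h1 : ‖mink a b‖ ≤ ‖minkL‖ * ‖a‖ * ‖b‖ := minkL.le_opNorm₂ a b
    calc ‖projHyp a b‖ ≤ ‖b‖ + ‖mink a b • a‖ := norm_add_le _ _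
      _ ≤ ‖b‖ + ‖minkL‖ * ‖a‖ * ‖b‖ * ‖a‖ := by rw [norm_smul]; gcongr
      _ ≤ ‖w‖ + ‖minkL‖ * ‖x‖ * ‖w‖ * ‖x‖ := by gcongr
      _ = _ := by ring
  exact max_le (key _ _ (norm_fst_le x) (norm_fst_le w))
    (key _ _ (norm_snd_le x) (norm_snd_le w))

lemma smooth_projHH {V : Type*} [NormedAddCommGroup V] [NormedSpace ℝ V] {a b : V → R6} {y : V}
    (ha : ContDiffAt ℝ ∞ a y) (hb : ContDiffAt ℝ ∞ b y) :
    ContDiffAt ℝ ∞ (fun z => projHH (a z) (b z)) y := by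
  have key : ∀ {c d : V → R3}, ContDiffAt ℝ ∞ c y → ContDiffAt ℝ ∞ d y →
      ContDiffAt ℝ ∞ (fun z => projHyp (c z) (d z)) y := by
    intro c d hc hd
    have hm : ContDiffAt ℝ ∞ (fun z => minkL (c z) (d z)) y :=
      (contDiffAt_const.clm_apply hc).clm_apply hd
    exact hd.add (hm.smul hc)
  exact (key ha.fst hb.fst).prodMk (key ha.snd hb.snd)

namespace GeodesicSurface

variable {f : E2 → R6} {Ω : Set E2} (hf : GeodesicSurface f Ω) {y : E2} (hy : y ∈ Ω)
include hf hy

/-- Existence of smooth Christoffel symbols `Q z (projHH (f z) (D2 f z u v))`. -/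
lemma exists_christoffel : ∃ Q : E2 → R6 →L[ℝ] E2, ContDiffAt ℝ ∞ Q y ∧
    ∀ᶠ z in 𝓝 y, z ∈ Ω ∧ ∀ u v, D2 f z u v =
      fderiv ℝ f z (Q z (projHH (f z) (D2 f z u v)))
        + (pull₁ f z u v • (f z).1, pull₂ f z u v • (f z).2) := by
  obtain ⟨Q, hQ, hQ'⟩ := exists_left_inverse_field (hf.smooth y hy) (hf.inj y hy)
  refine ⟨Q, hQ, ?_⟩
  filter_upwards [hf.eventually_mem hy, hQ'] with z hz hQz
  refine ⟨hz, fun u v => ?_⟩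
  obtain ⟨k, hk⟩ := hf.geodesic z hz u v
  rw [← hk, hQz, hk, hf.projHH_D2 hz]
  abel

/-- On a totally geodesic Lagrangian surface, the metrics pulled back from the two factors agree
where both projections are immersions. -/
lemma pull_eq (h1 : ∀ u, (fderiv ℝ f y u).1 = 0 → u = 0)
    (h2 : ∀ u, (fderiv ℝ f y u).2 = 0 → u = 0) (v w : E2) : pull₁ f y v w = pull₂ f y v w := by
  obtain ⟨Q, hQ, hev⟩ := hf.exists_christoffel hy
  have hΓ : ∀ u v, DifferentiableAt ℝ (fun z => Q z (projHH (f z) (D2 f z u v))) y := by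
    intro u v
    exact smooth_differentiableAt (hQ.clm_apply (smooth_projHH (hf.smooth y hy)
      (smooth_fderiv_apply (smooth_fderiv_apply (hf.smooth y hy) v) u)))
  have c1 := curvature_identity (hf.smooth_fst hy) (hf.sq_fst hy)
    (mink_fderiv_of_sq (smooth_differentiableAt (hf.smooth_fst hy)) (hf.eventually_sq_fst hy))
    hΓ (by
      filter_upwards [hev] with z hz u v
      rw [hf.D2_fst hz.1, hf.fderiv_fst hz.1, hf.fderiv_fst hz.1, hf.fderiv_fst hz.1]
      exact congrArg Prod.fst (hz.2 u v))
  have c2 := curvature_identity (hf.smooth_snd hy) (hf.sq_snd hy)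
    (mink_fderiv_of_sq (smooth_differentiableAt (hf.smooth_snd hy)) (hf.eventually_sq_snd hy))
    hΓ (by
      filter_upwards [hev] with z hz u v
      rw [hf.D2_snd hz.1, hf.fderiv_snd hz.1, hf.fderiv_snd hz.1, hf.fderiv_snd hz.1]
      exact congrArg Prod.snd (hz.2 u v))
  -- `c1` and `c2` contain the same Christoffel terms. Injectivity of the projections strips off the
  -- differentials, and subtraction leaves only the two metrics.
  have key : ∀ u v, (pull₁ f y v w - pull₂ f y v w) • u
      = (pull₁ f y u w - pull₂ f y u w) • v := by
    intro u v
    have d1 := c1 u v w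
    have d2 := c2 u v w
    rw [hf.fderiv_fst hy] at d1
    rw [hf.fderiv_snd hy] at d2
    have e := (h1 _ d1).trans (h2 _ d2).symm
    simp only [hf.fderiv_fst hy, hf.fderiv_snd hy] at e
    have e' := sub_eq_zero.2 e
    rw [← sub_eq_zero, ← e']
    simp only [pull₁, pull₂]
    module
  have a0 := congrArg (fun k : E2 => k 0) (key (basisVec 0) v)
  have a1 := congrArg (fun k : E2 => k 1) (key (basisVec 0) v)
  have b0 := congrArg (fun k : E2 => k 0) (key (basisVec 1) v)
  have b1 := congrArg (fun k : E2 => k 1) (key (basisVec 1) v)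
  simp [basisVec] at a0 a1 b0 b1
  -- With δ the difference at `(v, w)` and P₀, P₁ those at the basis vectors: δ = P₀v₀ = P₁v₁ and
  -- P₀v₁ = 0, so δ² = P₀v₀P₁v₁ = 0.
  have : (pull₁ f y v w - pull₂ f y v w) ^ 2 = 0 := by
    rw [sq]; nth_rw 1 [a0]; rw [b1]
    rcases a1 with h | h <;> rw [h] <;> ring
  exact sub_eq_zero.1 (pow_eq_zero_iff (two_ne_zero) |>.1 this)

/-- Unique continuation: a linear function of a totally geodesic surface satisfies a linear
second order system. -/
lemma exists_ball_unique {F : Type*} [NormedAddCommGroup F] [NormedSpace ℝ F] (L : R6 →L[ℝ] F)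
    (hL : ∀ z ∈ Ω, ∀ u v, ‖L (pull₁ f z u v • (f z).1, pull₂ f z u v • (f z).2)‖
      ≤ (|pull₁ f z u v| + |pull₂ f z u v|) * ‖L (f z)‖) :
    ∃ r > 0, ball y r ⊆ Ω ∧ ∀ y₁ ∈ ball y r, L (f y₁) = 0 →
      (∀ u, L (fderiv ℝ f y₁ u) = 0) → ∀ z ∈ ball y r, L (f z) = 0 := by
  obtain ⟨Q, hQ, hev⟩ := hf.exists_christoffel hy
  have bdd : ∀ {G : Type} [NormedAddCommGroup G] (g : E2 → G), ContinuousAt g y →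
      ∀ᶠ z in 𝓝 y, ‖g z‖ ≤ ‖g y‖ + 1 := fun g hg =>
    (hg.norm.eventually (gt_mem_nhds (lt_add_one _))).mono fun z hz => hz.le
  have hs := hf.smooth y hy
  have b0 := bdd f hs.continuousAt
  have b1 := bdd (fderiv ℝ f) (smooth_fderiv hs).continuousAt
  have b2 := bdd (fderiv ℝ (fderiv ℝ f)) (smooth_fderiv (smooth_fderiv hs)).continuousAt
  have b3 := bdd Q hQ.continuousAt
  obtain ⟨r, hr, hball⟩ := Metric.eventually_nhds_iff_ball.1
    (hev.and (b0.and (b1.and (b2.and b3))))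
  set A0 := ‖f y‖ + 1
  set A1 := ‖fderiv ℝ f y‖ + 1
  set A2 := ‖fderiv ℝ (fderiv ℝ f) y‖ + 1
  set A3 := ‖Q y‖ + 1
  have hsm : ∀ z ∈ ball y r, ContDiffAt ℝ ∞ f z := fun z hz => hf.smooth z (hball z hz).1.1
  refine ⟨r, hr, fun z hz => (hball z hz).1.1, fun y₁ hy₁ h0 h1 z hz => ?_⟩
  have hg : ContDiffOn ℝ ∞ (fun z => L (f z)) (ball y r) := fun z hz =>
    (L.contDiff.contDiffAt.comp z (hsm z hz)).contDiffWithinAt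
  -- The first summand of `C` bounds the Christoffel vector `k`, which multiplies the derivative of
  -- `L ∘ f`. The second bounds `|pull₁| + |pull₂|`, which multiplies `L ∘ f`.
  refine eq_zero_of_D2_le (C := A3 * ((1 + ‖minkL‖ * A0 * A0) * A2) + 2 * (‖minkL‖ * A1 * A1))
    hg ?_ hy₁ h0 ?_ hz
  · intro w hw d e
    obtain ⟨⟨hwΩ, hw0⟩, hw1, hw2, hw3, hw4⟩ := hball w hw
    set k := Q w (projHH (f w) (D2 f w d e)) with hk
    have hkn : ‖k‖ ≤ A3 * ((1 + ‖minkL‖ * A0 * A0) * (A2 * ‖d‖ * ‖e‖)) := by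
      calc ‖k‖ ≤ ‖Q w‖ * ‖projHH (f w) (D2 f w d e)‖ := ContinuousLinearMap.le_opNorm _ _
        _ ≤ ‖Q w‖ * ((1 + ‖minkL‖ * ‖f w‖ * ‖f w‖) * ‖D2 f w d e‖) := by
          gcongr; exact norm_projHH_le _ _
        _ ≤ ‖Q w‖ * ((1 + ‖minkL‖ * ‖f w‖ * ‖f w‖)
            * (‖fderiv ℝ (fderiv ℝ f) w‖ * ‖d‖ * ‖e‖)) := by
          rw [D2_eq (hsm w hw)]
          gcongr; exact ContinuousLinearMap.le_opNorm₂ _ _ _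
        _ ≤ _ := by gcongr
    have hp : ∀ a b : R3, ‖a‖ ≤ A1 * ‖d‖ → ‖b‖ ≤ A1 * ‖e‖ →
        |mink a b| ≤ ‖minkL‖ * A1 * A1 * ‖d‖ * ‖e‖ := by
      intro a b ha hb
      calc |mink a b| ≤ ‖minkL‖ * ‖a‖ * ‖b‖ := minkL.le_opNorm₂ a b
        _ ≤ ‖minkL‖ * (A1 * ‖d‖) * (A1 * ‖e‖) := by gcongr
        _ = _ := by ring
    have hfd : ∀ d, ‖fderiv ℝ f w d‖ ≤ A1 * ‖d‖ := fun d =>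
      (ContinuousLinearMap.le_opNorm _ _).trans (by gcongr)
    have hp1 : |pull₁ f w d e| ≤ ‖minkL‖ * A1 * A1 * ‖d‖ * ‖e‖ :=
      hp _ _ ((norm_fst_le _).trans (hfd d)) ((norm_fst_le _).trans (hfd e))
    have hp2 : |pull₂ f w d e| ≤ ‖minkL‖ * A1 * A1 * ‖d‖ * ‖e‖ :=
      hp _ _ ((norm_snd_le _).trans (hfd d)) ((norm_snd_le _).trans (hfd e))
    have hLk : L (fderiv ℝ f w k) = fderiv ℝ (fun z => L (f z)) w k :=
      (fderiv_clm L (smooth_differentiableAt (hsm w hw)) k).symm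
    rw [D2_clm L (hsm w hw), hw0 d e, map_add, hLk]
    calc _ ≤ ‖fderiv ℝ (fun z => L (f z)) w k‖
          + ‖L (pull₁ f w d e • (f w).1, pull₂ f w d e • (f w).2)‖ := norm_add_le _ _
      _ ≤ ‖fderiv ℝ (fun z => L (f z)) w‖ *
            (A3 * ((1 + ‖minkL‖ * A0 * A0) * (A2 * ‖d‖ * ‖e‖)))
          + (‖minkL‖ * A1 * A1 * ‖d‖ * ‖e‖ + ‖minkL‖ * A1 * A1 * ‖d‖ * ‖e‖) * ‖L (f w)‖ := by
        refine add_le_add ((ContinuousLinearMap.le_opNorm _ _).trans (by gcongr))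
          ((hL w hwΩ d e).trans (by gcongr))
      _ ≤ _ := by
        have p1 : 0 ≤ A3 * ((1 + ‖minkL‖ * A0 * A0) * A2) * ‖d‖ * ‖e‖ * ‖L (f w)‖ := by
          positivity
        have p2 : 0 ≤ 2 * (‖minkL‖ * A1 * A1) * ‖d‖ * ‖e‖ * ‖fderiv ℝ (fun z => L (f z)) w‖ := by
          positivity
        linarith
  · ext u
    rw [fderiv_clm L (smooth_differentiableAt (hsm y₁ hy₁)), h1]
    rfl

end GeodesicSurface

/-! ### Global consequences -/

lemma triple_expand (x : R3) (D : E2 →ₗ[ℝ] R3) (v w : E2) :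
    mink (lcross x (D v)) (D w) = (v 0 * w 1 - v 1 * w 0) *
      mink (lcross x (D (basisVec 0))) (D (basisVec 1)) := by
  conv_lhs => rw [eq_sum_basisVec v, eq_sum_basisVec w]
  simp only [map_add, map_smul, lcross_add_right, lcross_smul_right, mink_add_left,
    mink_add_right, mink_smul_left, mink_smul_right, mink_lcross_right]
  rw [mink_lcross_swap x (D (basisVec 1))]
  ring

section Surface

variable {M : Type*} [TopologicalSpace M] [ChartedSpace E2 M]

lemma clm_diff_eq_zero {F : Type*} [NormedAddCommGroup F] [NormedSpace ℝ F] {Φ : M → R6}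
    (hΦ : ContMDiff 𝓘(ℝ, E2) 𝓘(ℝ, R6) ∞ Φ) [IsManifold 𝓘(ℝ, E2) ∞ M] (L : R6 →L[ℝ] F)
    (h : ∀ q, L (Φ q) = 0) (q : M) (u : E2) : L (diff Φ q u) = 0 := by
  rw [diff_eq hΦ, ← fderiv_clm L (smooth_differentiableAt
    (localRep_smooth hΦ q (mem_chart_target E2 q)))]
  rw [show (fun z => L (localRep Φ q z)) = fun _ => 0 from funext fun z => h _]
  simp

/-- The Lagrangian condition as equality of the two pulled-back area forms; it ties the ranks of the
two projections together. -/
lemma triple_eq {Φ : M → R6} (hL : IsLagrangian Φ) (q : M) (u v : E2) : mink (lcross (Φ q).1 (diff Φ q u).1) (diff Φ q v).1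
    = mink (lcross (Φ q).2 (diff Φ q u).2) (diff Φ q v).2 := by
  have := hL q u v
  rw [kaehler_eq] at this
  exact sub_eq_zero.1 this

/-- The first projection of the surface is an immersion at `q`. -/
def FstImmersive (Φ : M → R6) (q : M) : Prop := ∀ u, (diff Φ q u).1 = 0 → u = 0

/-- The two factors induce the same metric at `q`. -/
def EqualPullbacks (Φ : M → R6) (q : M) : Prop :=
  ∀ u v, mink (diff Φ q u).1 (diff Φ q v).1 = mink (diff Φ q u).2 (diff Φ q v).2

variable [IsManifold 𝓘(ℝ, E2) ∞ M] {Φ : M → R6} (hΦ : IsImmersionHH Φ)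
include hΦ

/-- The differential of `l ∘ Φ` is injective between planes, hence onto, and maps with onto
differential are locally open. It supplies the open sets required by `IsOpenPart`. -/
lemma isOpen_range_of_injective (l : R6 →L[ℝ] E2)
    (h : ∀ p u, l (diff Φ p u) = 0 → u = 0) : IsOpen (Set.range fun p => l (Φ p)) := by
  rw [isOpen_iff_mem_nhds]
  rintro _ ⟨p, rfl⟩
  have hs : ContDiffAt ℝ ∞ (fun z => l (localRep Φ p z)) (chartAt E2 p p) :=
    l.contDiff.contDiffAt.comp _ (localRep_smooth hΦ.smooth p (mem_chart_target E2 p))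
  set D := fderiv ℝ (fun z => l (localRep Φ p z)) (chartAt E2 p p) with hD
  have hinj : Function.Injective D := by
    rw [injective_iff_map_eq_zero]
    intro u hu
    rw [hD, fderiv_clm l (smooth_differentiableAt
      (localRep_smooth hΦ.smooth p (mem_chart_target E2 p))), ← diff_eq hΦ.smooth] at hu
    exact h p u hu
  have hsurj : D.range = ⊤ :=
    LinearMap.range_eq_top.2 (LinearMap.injective_iff_surjective (f := (D : E2 →ₗ[ℝ] E2)).1 hinj)
  have key := (hs.hasStrictFDerivAt (by simp)).map_nhds_eq_of_surj hsurj
  rw [localRep_self] at key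
  rw [← key, mem_map]
  exact univ_mem' fun z => ⟨_, rfl⟩

lemma FstImmersive.pos {q : M} (h : FstImmersive Φ q) {u : E2} (hu : u ≠ 0) :
    0 < mink (diff Φ q u).1 (diff Φ q u).1 := by
  refine lt_of_le_of_ne (mink_self_nonneg (HH.sq_fst (hΦ.mem q)) (diff_tangent hΦ q u).1)
    fun h0 => hu (h u ?_)
  exact eq_zero_of_mink_self (HH.sq_fst (hΦ.mem q)) (diff_tangent hΦ q u).1 h0.symm

/-- The induced metric is then twice the first pullback. With `FstImmersive.equalPullbacks` this
makes the two conditions equivalent on a totally geodesic surface. -/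
lemma EqualPullbacks.fstImmersive {q : M} (hE : EqualPullbacks Φ q) : FstImmersive Φ q := by
  intro u hu
  refine inducedMetric_self_eq_zero hΦ q ?_
  unfold inducedMetric metric6
  rw [← hE, hu]
  simp

lemma fstImmersive_iff (q : M) : FstImmersive Φ q ↔
    mink (lcross (Φ q).1 (diff Φ q (basisVec 0)).1) (diff Φ q (basisVec 1)).1 ≠ 0 :=
  injective_iff_triple (D := (fstL.comp (diff Φ q) : E2 →L[ℝ] R3)) (HH.sq_fst (hΦ.mem q))
    fun u => (diff_tangent hΦ q u).1

lemma sndImmersive_iff (q : M) : (∀ u, (diff Φ q u).2 = 0 → u = 0) ↔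
    mink (lcross (Φ q).2 (diff Φ q (basisVec 0)).2) (diff Φ q (basisVec 1)).2 ≠ 0 :=
  injective_iff_triple (D := (sndL.comp (diff Φ q) : E2 →L[ℝ] R3)) (HH.sq_snd (hΦ.mem q))
    fun u => (diff_tangent hΦ q u).2

variable (hL : IsLagrangian Φ)
include hL

lemma fst_iff_snd (q : M) : FstImmersive Φ q ↔ ∀ u, (diff Φ q u).2 = 0 → u = 0 := by
  rw [fstImmersive_iff hΦ, sndImmersive_iff hΦ, triple_eq hL]

variable (hG : IsTotallyGeodesic Φ)
include hG

lemma localRep_geodesicSurface (p : M) :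
    GeodesicSurface (localRep Φ p) (chartAt E2 p).target :=
  { localRep_lagSurface hΦ hL p with geodesic := fun _ hy u v => hG.localRep hΦ p hy u v }

lemma FstImmersive.equalPullbacks {q : M} (h : FstImmersive Φ q) : EqualPullbacks Φ q := by
  intro u v
  have h2 := (fst_iff_snd hΦ hL q).1 h
  have := (localRep_geodesicSurface hΦ hL hG q).pull_eq (mem_chart_target E2 q)
  rw [← diff_eq hΦ.smooth] at this
  have := this h h2 u v
  unfold pull₁ pull₂ at this
  rwa [← diff_eq hΦ.smooth] at this

/-- Either both factors induce the same metric everywhere, or the projections to the factors are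
nowhere immersions. -/
lemma equalPullbacks_or [ConnectedSpace M] :
    (∀ q, EqualPullbacks Φ q) ∨ ∀ q, ¬ FstImmersive Φ q := by
  -- One set with two descriptions: a nonvanishing determinant (open) and an equality of metrics
  -- (closed).
  have hWE : {q | FstImmersive Φ q} = {q | EqualPullbacks Φ q} :=
    Set.ext fun q => ⟨fun h => h.equalPullbacks hΦ hL hG, fun h => h.fstImmersive hΦ⟩
  have hopen : IsOpen {q | FstImmersive Φ q} := by
    rw [isOpen_iff_mem_nhds]
    intro q hq
    set y := chartAt E2 q q
    have hs := localRep_smooth hΦ.smooth q (mem_chart_target E2 q)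
    let j : E2 → ℝ := fun z => minkL (lcrossL (localRep Φ q z).1
      (fderiv ℝ (localRep Φ q) z (basisVec 0)).1) (fderiv ℝ (localRep Φ q) z (basisVec 1)).1
    have hj : ContinuousAt j y := by
      have c0 := hs.continuousAt.fst
      have c1 := (smooth_fderiv_apply hs (basisVec 0)).continuousAt.fst
      have c2 := (smooth_fderiv_apply hs (basisVec 1)).continuousAt.fst
      exact (minkL.continuous.continuousAt.comp
        ((lcrossL.continuous.continuousAt.comp c0).clm_apply c1)).clm_apply c2
    have hj0 : j y ≠ 0 := by
      have h := (fstImmersive_iff hΦ q).1 hq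
      rw [diff_eq hΦ.smooth] at h
      simpa [j, y, localRep_self] using h
    have hev := ((chartAt E2 q).continuousAt (mem_chart_source E2 q)).eventually
      (hj.eventually_ne hj0)
    filter_upwards [hev, (chartAt E2 q).open_source.mem_nhds (mem_chart_source E2 q)]
      with q' h1 h2 u hu
    obtain ⟨T, S, hT, -⟩ := chart_transition hΦ.smooth q q' h2
    have hg := localRep_lagSurface hΦ hL q
    have hq't := (chartAt E2 q).map_source h2
    have h3 := (injective_iff_triple (D := (fstL.comp (fderiv ℝ (localRep Φ q)
      (chartAt E2 q q')) : E2 →L[ℝ] R3)) (hg.sq_fst hq't)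
      (fun u => (hg.tangent hq't u).1)).2 h1 (T.symm u) (by
        change (fderiv ℝ (localRep Φ q) (chartAt E2 q q') (T.symm u)).1 = 0
        rw [hT, T.apply_symm_apply, hu])
    simpa using h3
  have hclosed : IsClosed {q | EqualPullbacks Φ q} := by
    rw [← isOpen_compl_iff, isOpen_iff_mem_nhds]
    intro q hq
    have hs := localRep_smooth hΦ.smooth q (mem_chart_target E2 q)
    simp only [Set.mem_compl_iff, Set.mem_ofPred_eq, EqualPullbacks] at hq
    push Not at hq
    obtain ⟨u, v, huv⟩ := hq
    rw [diff_eq hΦ.smooth] at huv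
    have cu := (smooth_fderiv_apply hs u).continuousAt
    have cv := (smooth_fderiv_apply hs v).continuousAt
    have c1 : ContinuousAt (fun z => minkL (fderiv ℝ (localRep Φ q) z u).1
        (fderiv ℝ (localRep Φ q) z v).1) (chartAt E2 q q) :=
      (minkL.continuous.continuousAt.comp cu.fst).clm_apply cv.fst
    have c2 : ContinuousAt (fun z => minkL (fderiv ℝ (localRep Φ q) z u).2
        (fderiv ℝ (localRep Φ q) z v).2) (chartAt E2 q q) :=
      (minkL.continuous.continuousAt.comp cu.snd).clm_apply cv.snd
    have hev := ((chartAt E2 q).continuousAt (mem_chart_source E2 q)).eventually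
      ((c1.sub c2).eventually_ne (sub_ne_zero.2 huv))
    filter_upwards [hev, (chartAt E2 q).open_source.mem_nhds (mem_chart_source E2 q)]
      with q' h1 h2 h3
    obtain ⟨T, S, hT, -⟩ := chart_transition hΦ.smooth q q' h2
    apply h1
    simp only [Pi.sub_apply, minkL_apply, hT]
    rw [h3, sub_self]
  have hclopen : IsClopen {q | EqualPullbacks Φ q} := ⟨hclosed, hWE ▸ hopen⟩
  rcases isClopen_iff.1 hclopen with h | h
  · right
    intro q hq
    have : q ∈ {q | EqualPullbacks Φ q} := hq.equalPullbacks hΦ hL hG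
    rw [h] at this
    exact this
  · left
    intro q
    have : q ∈ {q | EqualPullbacks Φ q} := by rw [h]; trivial
    exact this

/-- Unique continuation for linear functions of a totally geodesic surface. -/
lemma clm_eq_zero_of_base [ConnectedSpace M] {F : Type*} [NormedAddCommGroup F] [NormedSpace ℝ F]
    (L : R6 →L[ℝ] F)
    (hB : ∀ q u v, ‖L (mink (diff Φ q u).1 (diff Φ q v).1 • (Φ q).1,
        mink (diff Φ q u).2 (diff Φ q v).2 • (Φ q).2)‖
      ≤ (|mink (diff Φ q u).1 (diff Φ q v).1| + |mink (diff Φ q u).2 (diff Φ q v).2|)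
        * ‖L (Φ q)‖)
    {p₀ : M} (h0 : L (Φ p₀) = 0) (h1 : ∀ u, L (diff Φ p₀ u) = 0) (q : M) : L (Φ q) = 0 := by
  have hball : ∀ q, ∃ r > 0, ball (chartAt E2 q q) r ⊆ (chartAt E2 q).target ∧
      ∀ y₁ ∈ ball (chartAt E2 q q) r, L (localRep Φ q y₁) = 0 →
      (∀ u, L (fderiv ℝ (localRep Φ q) y₁ u) = 0) →
      ∀ z ∈ ball (chartAt E2 q q) r, L (localRep Φ q z) = 0 := by
    intro q
    refine (localRep_geodesicSurface hΦ hL hG q).exists_ball_unique (mem_chart_target E2 q) L ?_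
    intro z hz u v
    have hqs := (chartAt E2 q).map_target hz
    obtain ⟨T, S, hT, -⟩ := chart_transition hΦ.smooth q _ hqs
    rw [(chartAt E2 q).right_inv hz] at hT
    simp only [pull₁, pull₂, hT]
    exact hB _ _ _
  have hnear : ∀ (q : M) (r : ℝ), 0 < r → ∀ᶠ q' in 𝓝 q,
      chartAt E2 q q' ∈ ball (chartAt E2 q q) r ∧ q' ∈ (chartAt E2 q).source := by
    intro q r hr
    exact (((chartAt E2 q).continuousAt (mem_chart_source E2 q)).eventually
      (ball_mem_nhds _ hr)).and ((chartAt E2 q).open_source.mem_nhds (mem_chart_source E2 q))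
  have hprop : ∀ (q : M) (r : ℝ), 0 < r →
      (∀ z ∈ ball (chartAt E2 q q) r, L (localRep Φ q z) = 0) → ∀ᶠ q' in 𝓝 q, L (Φ q') = 0 := by
    intro q r hr h
    filter_upwards [hnear q r hr] with q' hq'
    have := h _ hq'.1
    rwa [localRep, (chartAt E2 q).left_inv hq'.2] at this
  -- For closedness at a limit point `q`, the uniqueness ball around `q` contains a point near which
  -- `L ∘ Φ` vanishes. Its 1-jet is zero there, and the zero spreads over the whole ball.
  have hclopen : IsClopen {q | ∀ᶠ q' in 𝓝 q, L (Φ q') = 0} := by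
    constructor
    · rw [← closure_subset_iff_isClosed]
      intro q hq
      obtain ⟨r, hr, -, hz⟩ := hball q
      obtain ⟨q', hq', hq's⟩ := mem_closure_iff_nhds.1 hq _ (hnear q r hr)
      refine hprop q r hr (hz _ hq'.1 ?_ fun u => ?_)
      · rw [localRep, (chartAt E2 q).left_inv hq'.2]
        exact hq's.self_of_nhds
      · have hyt := (chartAt E2 q).map_source hq'.2
        rw [← fderiv_clm L (smooth_differentiableAt (localRep_smooth hΦ.smooth q hyt))]
        have hev : (fun z => L (localRep Φ q z)) =ᶠ[𝓝 (chartAt E2 q q')] fun _ => 0 := by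
          have hc := (chartAt E2 q).symm.continuousAt (x := chartAt E2 q q') hyt
          rw [ContinuousAt, (chartAt E2 q).left_inv hq'.2] at hc
          exact hc.eventually hq's
        rw [hev.fderiv_eq]
        simp
    · exact isOpen_iff_mem_nhds.2 fun q hq => hq.eventually_nhds
  have hne : p₀ ∈ {q | ∀ᶠ q' in 𝓝 q, L (Φ q') = 0} := by
    obtain ⟨r, hr, -, hz⟩ := hball p₀
    refine hprop p₀ r hr (hz _ (mem_ball_self hr) ?_ fun u => ?_)
    · rw [localRep_self, h0]
    · rw [← diff_eq hΦ.smooth, h1]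
  have huniv := hclopen.eq_univ ⟨p₀, hne⟩
  have : q ∈ {q | ∀ᶠ q' in 𝓝 q, L (Φ q') = 0} := by rw [huniv]; trivial
  exact (show ∀ᶠ q' in 𝓝 q, L (Φ q') = 0 from this).self_of_nhds

end Surface

/-! ### Complete geodesics of the hyperbolic plane -/

/-- The complete geodesic through `x` with velocity `a`. -/
def hypLine (x a : R3) (s : ℝ) : R3 := Real.cosh s • x + Real.sinh s • a

lemma hasDerivAt_hypLine (x a : R3) (s : ℝ) :
    HasDerivAt (hypLine x a) (Real.sinh s • x + Real.cosh s • a) s :=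
  ((Real.hasDerivAt_cosh s).smul_const x).add ((Real.hasDerivAt_sinh s).smul_const a)

lemma deriv_hypLine (x a : R3) : deriv (hypLine x a) = hypLine a x := by
  funext s
  rw [(hasDerivAt_hypLine x a s).deriv, hypLine, add_comm]

namespace UnitTangent

variable {x a : R3} (h : UnitTangent x a)
include h

lemma mink_hypLine_left (s : ℝ) : mink (hypLine x a s) x = -Real.cosh s := by
  simp [hypLine, mink_add_left, mink_smul_left, h.sq, mink_comm a x, h.orth]

lemma mink_hypLine_right (s : ℝ) : mink (hypLine x a s) a = Real.sinh s := by
  simp [hypLine, mink_add_left, mink_smul_left, h.unit, h.orth]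

lemma hypLine_mem (s : ℝ) : hypLine x a s ∈ hypPlane (-1) := by
  refine mem_hyp_of_mink_neg h.base ?_ ?_
  · nth_rw 2 [hypLine]
    rw [mink_add_right, mink_smul_right, mink_smul_right, h.mink_hypLine_left,
      h.mink_hypLine_right]
    nlinarith [Real.cosh_sq s]
  · rw [h.mink_hypLine_left]
    linarith [Real.cosh_pos s]

lemma isUnitSpeedGeodesic : IsUnitSpeedGeodesic Set.univ (hypLine x a) where
  isOpen := isOpen_univ
  ordConnected := Set.ordConnected_univ
  nonempty := Set.univ_nonempty
  smooth := ((Real.contDiff_cosh.smul contDiff_const).add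
    (Real.contDiff_sinh.smul contDiff_const)).contDiffOn
  mem s _ := h.hypLine_mem s
  unitSpeed s _ := by
    rw [deriv_hypLine]
    simp only [hypLine, mink_add_left, mink_smul_left, mink_add_right, mink_smul_right, h.unit,
      h.orth, h.sq, mink_comm a x]
    nlinarith [Real.cosh_sq s]
  geodesic s _ := by
    have e : mink (hypLine x a s) (hypLine x a s) = -1 := (mem_hyp.1 (h.hypLine_mem s)).1
    rw [deriv_hypLine, deriv_hypLine, projHyp, e]
    simp

/-- Such a `z` lies in the span of `x` and `a`. The parameter is read off from sinh s = ⟨z, a⟩, and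
lying on the same sheet as `x` fixes the sign of the cosh coefficient. -/
lemma exists_hypLine_eq {z : R3} (hz : z ∈ hypPlane (-1)) (hn : mink (lcross x a) z = 0) :
    ∃ s, hypLine x a s = z := by
  have e := h.expand z
  rw [mink_comm z (lcross x a), hn, zero_smul, add_zero] at e
  have hc := mink_neg_of_mem hz h.base
  refine ⟨Real.arsinh (mink z a), ?_⟩
  have hzz : mink z z = -1 := (mem_hyp.1 hz).1
  have h2 : mink z z = -(mink z x) ^ 2 + mink z a ^ 2 := by
    nth_rw 2 [e]
    rw [mink_add_right, mink_smul_right, mink_smul_right]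
    ring
  have h3 : Real.cosh (Real.arsinh (mink z a)) = -mink z x := by
    rw [Real.cosh_arsinh, show 1 + mink z a ^ 2 = (-mink z x) ^ 2 by nlinarith]
    exact Real.sqrt_sq (by linarith)
  rw [hypLine, h3, Real.sinh_arsinh]
  exact e.symm

/-- Vectors tangent to the geodesic are detected by their component along `a`. -/
lemma eq_zero_of_line {y v : R3} (hy : y ∈ hypPlane (-1)) (hv : mink y v = 0)
    (hn : mink (lcross x a) v = 0) (ha : mink v a = 0) :
    v = 0 := by
  have e := h.expand v
  rw [mink_comm v (lcross x a), hn, ha, zero_smul, zero_smul, add_zero, add_zero] at e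
  have h1 : mink y v = -mink v x * mink y x := by
    nth_rw 1 [e]
    rw [mink_smul_right]
  rw [hv] at h1
  have h2 := (mul_eq_zero.1 h1.symm).resolve_right (mink_neg_of_mem hy h.base).ne
  rw [e, h2, zero_smul]

end UnitTangent

/-! ### Unit tangents, the diagonal, and frame isometries -/

lemma exists_unitTangent {x w : R3} (hx : x ∈ hypPlane (-1)) (hw : mink x w = 0) (h : w ≠ 0) :
    0 < mink w w ∧ UnitTangent x ((√(mink w w))⁻¹ • w) := by
  have hsq := (mem_hyp.1 hx).1
  have hpos : 0 < mink w w := lt_of_le_of_ne (mink_self_nonneg hsq hw)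
    fun h0 => h (eq_zero_of_mink_self hsq hw h0.symm)
  refine ⟨hpos, hx, ?_, by rw [mink_smul_right, hw, mul_zero]⟩
  have h1 := Real.mul_self_sqrt hpos.le
  have h2 : √(mink w w) ≠ 0 := (Real.sqrt_pos.2 hpos).ne'
  rw [mink_smul_left, mink_smul_right]
  field_simp
  rw [sq, h1]

lemma mem_diagonal {z : R6} : z ∈ diagonal ↔ z.1 = z.2 ∧ z.1 ∈ hypPlane (-1) := by
  have h2 : √2 * √2 = 2 := Real.mul_self_sqrt (by norm_num)
  have hp : 0 < √2 := by positivity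
  constructor
  · rintro ⟨x, ⟨hx, hx0⟩, rfl⟩
    refine ⟨rfl, mem_hyp.2 ⟨?_, ?_⟩⟩
    · simp only [mink_smul_left, mink_smul_right, hx]
      field_simp
      nlinarith
    · exact mul_pos (inv_pos.2 hp) hx0
  · rintro ⟨h, hz⟩
    obtain ⟨hz, hz0⟩ := mem_hyp.1 hz
    refine ⟨√2 • z.1, ⟨?_, mul_pos hp hz0⟩, ?_⟩
    · rw [mink_smul_left, mink_smul_right, hz]
      linarith
    · refine Prod.ext ?_ ?_
      · simp [smul_smul]
      · simp [smul_smul, h]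

lemma mem_HH_of_mem_diagonal {z : R6} (hz : z ∈ diagonal) : z ∈ HH := by
  obtain ⟨h, h1⟩ := mem_diagonal.1 hz
  exact ⟨h1, h ▸ h1⟩

lemma hyp_eq_of_coords {x y : R3} (hx : x ∈ hypPlane (-1)) (hy : y ∈ hypPlane (-1))
    (h1 : x 1 = y 1) (h2 : x 2 = y 2) : x = y := by
  obtain ⟨hx, hx0⟩ := mem_hyp.1 hx
  obtain ⟨hy, hy0⟩ := mem_hyp.1 hy
  have h0 : x 0 = y 0 := by
    simp only [mink, h1, h2] at hx hy
    nlinarith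
  ext i; fin_cases i
  exacts [h0, h1, h2]

/-- A pair of linear functionals as a linear map to the model plane. -/
def pairL (l m : R6 →L[ℝ] ℝ) : R6 →L[ℝ] E2 :=
  LinearMap.toContinuousLinearMap
    { toFun := fun v => !₂[l v, m v]
      map_add' := fun u v => by ext i; fin_cases i <;> simp
      map_smul' := fun t v => by ext i; fin_cases i <;> simp }

lemma pairL_eq_iff {l m : R6 →L[ℝ] ℝ} {v w : R6} :
    pairL l m v = pairL l m w ↔ l v = l w ∧ m v = m w := by
  constructor
  · intro h
    exact ⟨congrArg (fun k : E2 => k 0) h, congrArg (fun k : E2 => k 1) h⟩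
  · rintro ⟨h1, h2⟩
    ext i; fin_cases i
    exacts [h1, h2]

/-- The isometry `(x, y) ↦ (A x, y)` where `A` carries one orthonormal frame to another. -/
lemma isIsometryHH_frameMap {x a y b : R3} (h : UnitTangent x a) (k : UnitTangent y b) :
    IsIsometryHH ((frameMap x a y b).prodMap (ContinuousLinearMap.id ℝ R3)) ∧
      IsHolomorphicHH ((frameMap x a y b).prodMap (ContinuousLinearMap.id ℝ R3)) := by
  refine ⟨⟨⟨Set.univ, isOpen_univ, Set.subset_univ _, ContinuousLinearMap.contDiff _ |>.contDiffOn⟩,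
    ⟨?_, ?_, ?_⟩, ?_⟩, ?_⟩
  · exact fun z hz => ⟨h.frameMap_mem k hz.1, hz.2⟩
  · intro z _ w _ hzw
    have h2 := congrArg (fun v : R6 => v.2) hzw
    refine Prod.ext ?_ h2
    have := congrArg (fun v : R6 => frameMap y b x a v.1) hzw
    simpa [h.frameMap_frameMap k] using this
  · intro z hz
    exact ⟨(frameMap y b x a z.1, z.2), ⟨k.frameMap_mem h hz.1, hz.2⟩,
      Prod.ext (k.frameMap_frameMap h z.1) rfl⟩
  · intro z _ v _ w _
    rw [ContinuousLinearMap.fderiv]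
    simp [metric6, h.mink_frameMap k]
  · intro z _ v _
    rw [ContinuousLinearMap.fderiv]
    simp [complexJ, h.lcross_frameMap k]

/-! ### Classification of totally geodesic Lagrangian surfaces -/

section Surface

variable {M : Type*} [TopologicalSpace M] [ChartedSpace E2 M]
  [IsManifold 𝓘(ℝ, E2) ∞ M] [ConnectedSpace M] {Φ : M → R6} (hΦ : IsImmersionHH Φ)
  (hL : IsLagrangian Φ) (hG : IsTotallyGeodesic Φ)
include hΦ hL hG

/-- At a base point both area forms vanish while `diff Φ p` is injective, so each projection has
rank one. Its direction singles out a geodesic in each factor, and unique continuation confines the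
whole surface to this pair. -/
lemma isProductOfGeodesics_of_degenerate (hd : ∀ q, ¬ FstImmersive Φ q) :
    IsProductOfGeodesics Φ := by
  obtain ⟨p⟩ := (inferInstance : Nonempty M)
  have hT1 : ∀ u v, mink (lcross (Φ p).1 (diff Φ p u).1) (diff Φ p v).1 = 0 := by
    intro u v
    have h0 := hd p
    rw [fstImmersive_iff hΦ, not_not] at h0
    refine (triple_expand _ (fstL.comp (diff Φ p) : E2 →L[ℝ] R3) u v).trans ?_
    exact mul_eq_zero_of_right _ h0
  have hT2 : ∀ u v, mink (lcross (Φ p).2 (diff Φ p u).2) (diff Φ p v).2 = 0 := fun u v => by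
    rw [← triple_eq hL, hT1]
  have hd2 : ¬ ∀ u, (diff Φ p u).2 = 0 → u = 0 := fun h => hd p ((fst_iff_snd hΦ hL p).2 h)
  obtain ⟨u, hu⟩ : ∃ u, (diff Φ p u).1 ≠ 0 := by
    by_contra! h
    refine hd2 fun u hu => (injective_iff_map_eq_zero _).1 (hΦ.injective p) u ?_
    exact Prod.ext (h u) hu
  obtain ⟨v, hv⟩ : ∃ v, (diff Φ p v).2 ≠ 0 := by
    by_contra! h
    refine hd p fun u hu => (injective_iff_map_eq_zero _).1 (hΦ.injective p) u ?_
    exact Prod.ext hu (h u)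
  obtain ⟨-, ha⟩ := exists_unitTangent (hΦ.mem p).1 (diff_tangent hΦ p u).1 hu
  obtain ⟨-, hb⟩ := exists_unitTangent (hΦ.mem p).2 (diff_tangent hΦ p v).2 hv
  set x := (Φ p).1
  set y := (Φ p).2
  set a := (√(mink (diff Φ p u).1 (diff Φ p u).1))⁻¹ • (diff Φ p u).1 with ha'
  set b := (√(mink (diff Φ p v).2 (diff Φ p v).2))⁻¹ • (diff Φ p v).2 with hb'
  -- This functional reads only the first factor, so it sends the normal term to a multiple of its
  -- own value; its 1-jet vanishes at `p` because the first projection has image along `a`.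
  have hn1 : ∀ q, ((minkL (lcross x a)).comp fstL) (Φ q) = 0 := by
    refine clm_eq_zero_of_base hΦ hL hG _ (fun q u v => ?_) (mink_lcross_left x a) (fun w => ?_)
    · simp only [ContinuousLinearMap.comp_apply, ContinuousLinearMap.coe_fst', map_smul,
        norm_smul, Real.norm_eq_abs]
      gcongr
      exact le_add_of_nonneg_right (abs_nonneg _)
    · simp only [ContinuousLinearMap.comp_apply, ContinuousLinearMap.coe_fst', minkL_apply, ha',
        lcross_smul_right, mink_smul_left, x, hT1, mul_zero]
  have hn2 : ∀ q, ((minkL (lcross y b)).comp sndL) (Φ q) = 0 := by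
    refine clm_eq_zero_of_base hΦ hL hG _ (fun q u v => ?_) (mink_lcross_left y b) (fun w => ?_)
    · simp only [ContinuousLinearMap.comp_apply, ContinuousLinearMap.coe_snd', map_smul,
        norm_smul, Real.norm_eq_abs]
      gcongr
      exact le_add_of_nonneg_left (abs_nonneg _)
    · simp only [ContinuousLinearMap.comp_apply, ContinuousLinearMap.coe_snd', minkL_apply, hb',
        lcross_smul_right, mink_smul_left, y, hT2, mul_zero]
  have hm1 := clm_diff_eq_zero hΦ.smooth _ hn1
  have hm2 := clm_diff_eq_zero hΦ.smooth _ hn2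
  let l := pairL ((minkL a).comp fstL) ((minkL b).comp sndL)
  have hl : ∀ v w, l v = l w ↔ mink a v.1 = mink a w.1 ∧ mink b v.2 = mink b w.2 :=
    fun v w => pairL_eq_iff
  have hopen := isOpen_range_of_injective hΦ l (by
    intro q w hw
    rw [← map_zero l, hl] at hw
    obtain ⟨w1, w2⟩ := hw
    simp only [Prod.fst_zero, Prod.snd_zero, mink_zero_right] at w1 w2
    refine (injective_iff_map_eq_zero _).1 (hΦ.injective q) w (Prod.ext ?_ ?_)
    · exact ha.eq_zero_of_line (hΦ.mem q).1 (diff_tangent hΦ q w).1 (hm1 q w)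
        ((mink_comm _ _).trans w1)
    · exact hb.eq_zero_of_line (hΦ.mem q).2 (diff_tangent hΦ q w).2 (hm2 q w)
        ((mink_comm _ _).trans w2))
  -- Complete geodesics are used. The open set is the preimage of the image under `l`, and `l`
  -- separates points of the product because its values there are the sinh of the two parameters.
  refine ⟨Set.univ, Set.univ, hypLine x a, hypLine y b, ha.isUnitSpeedGeodesic,
    hb.isUnitSpeedGeodesic, l ⁻¹' Set.range (fun p => l (Φ p)), hopen.preimage l.continuous, ?_⟩
  have hmem : ∀ q, Φ q ∈ productOfCurves Set.univ Set.univ (hypLine x a) (hypLine y b) := by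
    intro q
    obtain ⟨s, hs⟩ := ha.exists_hypLine_eq (hΦ.mem q).1 (hn1 q)
    obtain ⟨t, ht⟩ := hb.exists_hypLine_eq (hΦ.mem q).2 (hn2 q)
    exact ⟨⟨s, trivial, hs⟩, ⟨t, trivial, ht⟩⟩
  ext z
  constructor
  · rintro ⟨q, rfl⟩
    exact ⟨⟨q, rfl⟩, hmem q⟩
  · rintro ⟨⟨q, hq⟩, ⟨s, -, hs⟩, ⟨t, -, ht⟩⟩
    obtain ⟨⟨s', -, hs'⟩, ⟨t', -, ht'⟩⟩ := hmem q
    refine ⟨q, ?_⟩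
    obtain ⟨e1, e2⟩ := (hl _ _).1 hq
    rw [← hs, ← hs', mink_comm, ha.mink_hypLine_right, mink_comm, ha.mink_hypLine_right] at e1
    rw [← ht, ← ht', mink_comm, hb.mink_hypLine_right, mink_comm, hb.mink_hypLine_right] at e2
    refine Prod.ext ?_ ?_
    · rw [← hs, ← hs', Real.sinh_injective e1]
    · rw [← ht, ← ht', Real.sinh_injective e2]

/-- At `p` the two projections induce the same metric and the same area form, so one orientation
preserving Lorentz map `A` matches their 1-jets. As g₁ = g₂ everywhere, `A ∘ Φ₁ - Φ₂` satisfies the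
linear system of unique continuation. -/
lemma isCongruentToDiagonal_of_equalPullbacks (hE : ∀ q, EqualPullbacks Φ q) :
    IsCongruentToDiagonal Φ := by
  obtain ⟨p⟩ := (inferInstance : Nonempty M)
  have hu : basisVec 0 ≠ 0 := by simp [basisVec]
  set u := basisVec 0
  have hpos := ((hE p).fstImmersive hΦ).pos hΦ hu
  obtain ⟨-, ha⟩ := exists_unitTangent (hΦ.mem p).1 (diff_tangent hΦ p u).1
    (fun h => by rw [h] at hpos; simp at hpos)
  obtain ⟨-, hb⟩ := exists_unitTangent (hΦ.mem p).2 (diff_tangent hΦ p u).2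
    (fun h => by rw [hE, h] at hpos; simp at hpos)
  -- The two components of `diff Φ p u` have equal length, so the same factor `t` normalizes both.
  rw [← hE] at hb
  set t := (√(mink (diff Φ p u).1 (diff Φ p u).1))⁻¹
  set A := frameMap (Φ p).1 (t • (diff Φ p u).1) (Φ p).2 (t • (diff Φ p u).2) with hA
  have hAf : ∀ q, (A.comp fstL - sndL) (Φ q) = 0 := by
    refine clm_eq_zero_of_base hΦ hL hG _ (fun q v w => ?_) (p₀ := p) ?_ (fun w => ?_)
    · rw [← hE]
      simp only [sub_apply, ContinuousLinearMap.comp_apply, ContinuousLinearMap.coe_fst',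
        ContinuousLinearMap.coe_snd', map_smul, ← smul_sub, norm_smul, Real.norm_eq_abs]
      gcongr
      exact le_add_of_nonneg_right (abs_nonneg _)
    · exact sub_eq_zero.2 ha.frameMap_base
    · refine sub_eq_zero.2 ?_
      change A (diff Φ p w).1 = (diff Φ p w).2
      -- In the adapted frames the components along the unit tangents agree by `hE`, and those along
      -- the cross products by `triple_eq`.
      rw [hb.expand (diff Φ p w).2, hA, frameMap_apply]
      rw [mink_comm _ (Φ p).1, (diff_tangent hΦ p w).1, mink_comm _ (Φ p).2,
        (diff_tangent hΦ p w).2, mink_smul_right, mink_smul_right, hE, lcross_smul_right,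
        mink_smul_right, mink_comm _ (lcross _ _), triple_eq hL, lcross_smul_right,
        mink_smul_right, mink_comm _ (lcross _ _)]
  have hA1 : ∀ q, A (Φ q).1 = (Φ q).2 := fun q => sub_eq_zero.1 (hAf q)
  obtain ⟨hF, hFh⟩ := isIsometryHH_frameMap ha hb
  let c : Fin 3 → R6 →L[ℝ] ℝ := fun i => (ContinuousLinearMap.proj (R := ℝ)
    (φ := fun _ : Fin 3 => ℝ) i).comp sndL
  let l := pairL (c 1) (c 2)
  have hl : ∀ v w, l v = l w ↔ v.2 1 = w.2 1 ∧ v.2 2 = w.2 2 := fun v w => pairL_eq_iff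
  have hopen := isOpen_range_of_injective hΦ l (by
    intro q w hw
    rw [← map_zero l, hl] at hw
    refine (fst_iff_snd hΦ hL q).1 ((hE q).fstImmersive hΦ) w ?_
    exact eq_zero_of_coords (HH.sq_snd (hΦ.mem q)) (diff_tangent hΦ q w).2 hw.1 hw.2)
  refine ⟨_, hF, Or.inl hFh, l ⁻¹' Set.range (fun p => l (Φ p)), hopen.preimage l.continuous, ?_⟩
  ext z
  constructor
  · rintro ⟨_, ⟨q, rfl⟩, rfl⟩
    exact ⟨⟨q, (hl _ _).2 ⟨rfl, rfl⟩⟩, mem_diagonal.2 ⟨hA1 q, ha.frameMap_mem hb (hΦ.mem q).1⟩⟩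
  · rintro ⟨⟨q, hq⟩, hz⟩
    obtain ⟨h1, h2⟩ := mem_diagonal.1 hz
    obtain ⟨e1, e2⟩ := (hl _ _).1 hq
    have e := hyp_eq_of_coords (hΦ.mem q).2 (h1 ▸ h2) e1 e2
    exact ⟨Φ q, ⟨q, rfl⟩, Prod.ext ((hA1 q).trans (e.trans h1.symm)) e⟩

lemma IsTotallyGeodesic.classification :
    IsProductOfGeodesics Φ ∨ IsCongruentToDiagonal Φ := by
  rcases equalPullbacks_or hΦ hL hG with h | h
  · exact Or.inr (isCongruentToDiagonal_of_equalPullbacks hΦ hL hG h)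
  · exact Or.inl (isProductOfGeodesics_of_degenerate hΦ hL hG h)

end Surface

/-! ### The models are totally geodesic -/

/-- A geodesic of `ℍ²` lies in a plane through the origin. -/
lemma IsUnitSpeedGeodesic.exists_unitTangent {I : Set ℝ} {β : ℝ → R3}
    (h : IsUnitSpeedGeodesic I β) :
    ∃ x a, UnitTangent x a ∧ ∀ s ∈ I, mink (lcross x a) (β s) = 0 := by
  obtain ⟨s₀, hs₀⟩ := h.nonempty
  have hs : ∀ s ∈ I, ContDiffAt ℝ ∞ β s := fun s hs =>
    h.smooth.contDiffAt (h.isOpen.mem_nhds hs)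
  have hd : ∀ s ∈ I, HasDerivAt β (deriv β s) s := fun s hs' =>
    (smooth_differentiableAt (hs s hs')).hasDerivAt
  have hdd : ∀ s ∈ I, HasDerivAt (deriv β) (deriv (deriv β) s) s := fun s hs' =>
    (smooth_differentiableAt (smooth_fderiv_apply (hs s hs') 1)).hasDerivAt
  have orth : ∀ s ∈ I, mink (β s) (deriv β s) = 0 := fun s hs' =>
    mink_fderiv_of_sq (smooth_differentiableAt (hs s hs'))
      (Filter.eventually_of_mem (h.isOpen.mem_nhds hs') fun t ht => (mem_hyp.1 (h.mem t ht)).1) 1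
  -- The normal β × β' is constant: its derivative is β' × β' + β × β'', and the geodesic equation
  -- makes β'' parallel to β.
  have hn : ∀ s ∈ I, HasDerivAt (fun s => lcross (β s) (deriv β s)) 0 s := by
    intro s hs'
    have e : deriv (fun s => lcross (β s) (deriv β s)) s
        = lcross (deriv β s) (deriv β s) + lcross (β s) (deriv (deriv β) s) :=
      fderiv_bilin lcrossL (hd s hs').differentiableAt (hdd s hs').differentiableAt 1
    have hg := h.geodesic s hs'
    rw [projHyp, add_eq_zero_iff_eq_neg] at hg
    rw [lcross_self, zero_add, hg, ← neg_smul, lcross_smul_right, lcross_self, smul_zero] at e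
    rw [← e]
    exact (lcrossL.hasFDerivAt_of_bilinear (hd s hs').hasFDerivAt
      (hdd s hs').hasFDerivAt).differentiableAt.hasDerivAt
  refine ⟨β s₀, deriv β s₀, ⟨h.mem s₀ hs₀, h.unitSpeed s₀ hs₀, orth s₀ hs₀⟩, fun s hs' => ?_⟩
  have := h.isOpen.is_const_of_deriv_eq_zero h.ordConnected.isPreconnected
    (fun s hs' => (hn s hs').differentiableAt.differentiableWithinAt)
    (fun s hs' => (hn s hs').deriv) hs₀ hs'
  rw [this, mink_lcross_left]

/-! ### Invariance of the Levi-Civita connection under isometries -/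

/-- Koszul's formula: the tangential second derivatives of a parametrization are determined by
its metric. -/
lemma metric6_D2_eq {V : Type*} [NormedAddCommGroup V] [NormedSpace ℝ V] {X Y : V → R6}
    (hX : ContDiff ℝ ∞ X) (hY : ContDiff ℝ ∞ Y)
    (h : ∀ c j k, metric6 (fderiv ℝ X c j) (fderiv ℝ X c k)
      = metric6 (fderiv ℝ Y c j) (fderiv ℝ Y c k)) (c i j k : V) :
    metric6 (D2 X c i j) (fderiv ℝ X c k) = metric6 (D2 Y c i j) (fderiv ℝ Y c k) := by
  have key : ∀ {Z : V → R6}, ContDiff ℝ ∞ Z → ∀ i j k,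
      fderiv ℝ (fun c => metric6 (fderiv ℝ Z c j) (fderiv ℝ Z c k)) c i
        = metric6 (D2 Z c i j) (fderiv ℝ Z c k) + metric6 (D2 Z c i k) (fderiv ℝ Z c j) := by
    intro Z hZ i j k
    rw [metric6_comm (D2 Z c i k)]
    exact fderiv_bilin metricL
      (smooth_differentiableAt (smooth_fderiv_apply hZ.contDiffAt j))
      (smooth_differentiableAt (smooth_fderiv_apply hZ.contDiffAt k)) i
  have e : ∀ i j k, metric6 (D2 X c i j) (fderiv ℝ X c k)
      + metric6 (D2 X c i k) (fderiv ℝ X c j) = metric6 (D2 Y c i j) (fderiv ℝ Y c k)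
      + metric6 (D2 Y c i k) (fderiv ℝ Y c j) := by
    intro i j k
    rw [← key hX, ← key hY]
    simp only [h]
  -- Koszul's combination: after the symmetries of `D2`, `e1 - e2 + e3` isolates twice the wanted
  -- term.
  have e1 := e i j k
  have e2 := e k i j
  have e3 := e j k i
  rw [D2_symm hX.contDiffAt k i, D2_symm hY.contDiffAt k i] at e2
  rw [D2_symm hX.contDiffAt j i, D2_symm hY.contDiffAt j i,
    D2_symm hX.contDiffAt j k, D2_symm hY.contDiffAt j k] at e3
  linarith

/-- The parametrization of `ℍ²` as a graph. -/
def hypGraph (c : ℝ × ℝ) : R3 := ![√(1 + c.1 ^ 2 + c.2 ^ 2), c.1, c.2]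

lemma hypGraph_mem (c : ℝ × ℝ) : hypGraph c ∈ hypPlane (-1) := by
  have h : 0 < 1 + c.1 ^ 2 + c.2 ^ 2 := by positivity
  have h1 := Real.mul_self_sqrt h.le
  refine mem_hyp.2 ⟨?_, ?_⟩
  · simp only [mink, hypGraph, Matrix.cons_val]
    nlinarith
  · simpa [hypGraph] using Real.sqrt_pos.2 h

lemma contDiff_hypGraph : ContDiff ℝ ∞ hypGraph := by
  rw [contDiff_pi]
  intro i
  fin_cases i
  · have h : ContDiff ℝ ∞ fun c : ℝ × ℝ => 1 + c.1 ^ 2 + c.2 ^ 2 := by fun_prop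
    exact h.sqrt fun c => by positivity
  · exact contDiff_fst
  · exact contDiff_snd

/-- The parametrization of `ℍ² × ℍ²` as a graph. -/
def graphHH (c : (ℝ × ℝ) × (ℝ × ℝ)) : R6 := (hypGraph c.1, hypGraph c.2)

lemma graphHH_mem (c : (ℝ × ℝ) × (ℝ × ℝ)) : graphHH c ∈ HH := ⟨hypGraph_mem _, hypGraph_mem _⟩

lemma contDiff_graphHH : ContDiff ℝ ∞ graphHH :=
  (contDiff_hypGraph.comp contDiff_fst).prodMk (contDiff_hypGraph.comp contDiff_snd)

/-- The linear map inverting `graphHH`. -/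
def shadow : R6 →L[ℝ] (ℝ × ℝ) × (ℝ × ℝ) :=
  LinearMap.toContinuousLinearMap
    { toFun := fun v => ((v.1 1, v.1 2), (v.2 1, v.2 2))
      map_add' := fun _ _ => rfl
      map_smul' := fun _ _ => rfl }

lemma shadow_apply (v : R6) : shadow v = ((v.1 1, v.1 2), (v.2 1, v.2 2)) := rfl

lemma shadow_graphHH (c : (ℝ × ℝ) × (ℝ × ℝ)) : shadow (graphHH c) = c := by
  simp [shadow_apply, graphHH, hypGraph]

lemma graphHH_shadow {z : R6} (hz : z ∈ HH) : graphHH (shadow z) = z :=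
  Prod.ext (hyp_eq_of_coords (hypGraph_mem _) hz.1 (by simp [graphHH, hypGraph, shadow_apply])
      (by simp [graphHH, hypGraph, shadow_apply]))
    (hyp_eq_of_coords (hypGraph_mem _) hz.2 (by simp [graphHH, hypGraph, shadow_apply])
      (by simp [graphHH, hypGraph, shadow_apply]))

lemma eq_zero_of_shadow {x v : R6} (hx : x ∈ HH) (hv : v ∈ tangentHH x) (h : shadow v = 0) :
    v = 0 := by
  simp only [shadow_apply, Prod.mk_eq_zero] at h
  exact Prod.ext (eq_zero_of_coords (HH.sq_fst hx) hv.1 h.1.1 h.1.2)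
    (eq_zero_of_coords (HH.sq_snd hx) hv.2 h.2.1 h.2.2)

lemma fderiv_graphHH_shadow {c : (ℝ × ℝ) × (ℝ × ℝ)} {v : R6} (hv : v ∈ tangentHH (graphHH c)) :
    fderiv ℝ graphHH c (shadow v) = v := by
  have hd : DifferentiableAt ℝ graphHH c := smooth_differentiableAt contDiff_graphHH.contDiffAt
  have h1 : ∀ w, shadow (fderiv ℝ graphHH c w) = w := by
    intro w
    rw [← fderiv_clm shadow hd, show (fun z => shadow (graphHH z)) = id from
      funext shadow_graphHH]
    simp
  refine sub_eq_zero.1 (eq_zero_of_shadow (graphHH_mem c) ?_ ?_)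
  · exact (tangentSub (graphHH c)).sub_mem (fderiv_mem_tangentHH hd
      (Eventually.of_forall graphHH_mem) _) hv
  · rw [map_sub, h1, sub_self]

/-- Isometries of `ℍ² × ℍ²` preserve covariant second derivatives. -/
lemma IsIsometryHH.metric6_D2 {F : R6 → R6} (hF : IsIsometryHH F) {f : E2 → R6} {y : E2}
    (hf : ContDiffAt ℝ ∞ f y) (hm : ∀ z, f z ∈ HH) :
    ContDiffAt ℝ ∞ (fun z => F (f z)) y ∧ ∀ w ∈ tangentHH (f y), ∃ w' ∈ tangentHH (F (f y)),
      (∀ u, metric6 (fderiv ℝ (fun z => F (f z)) y u) w' = metric6 (fderiv ℝ f y u) w) ∧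
      ∀ u v, metric6 (D2 (fun z => F (f z)) y u v) w' = metric6 (D2 f y u v) w := by
  obtain ⟨U, hU, hHU, hFU⟩ := hF.smooth
  have hFs : ∀ z ∈ HH, ContDiffAt ℝ ∞ F z := fun z hz =>
    hFU.contDiffAt (hU.mem_nhds (hHU hz))
  -- The metric condition on `F` holds only along ℍ² × ℍ². Composing with the global graph chart
  -- gives two parametrizations with the same metric on a vector space, to which Koszul's formula
  -- applies.
  let Y : (ℝ × ℝ) × (ℝ × ℝ) → R6 := fun c => F (graphHH c)
  have hY : ContDiff ℝ ∞ Y := contDiff_iff_contDiffAt.2 fun c =>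
    (hFs _ (graphHH_mem c)).comp c contDiff_graphHH.contDiffAt
  have hYm : ∀ c, Y c ∈ HH := fun c => hF.bijOn.mapsTo (graphHH_mem c)
  have hXt : ∀ c k, fderiv ℝ graphHH c k ∈ tangentHH (graphHH c) := fun c k =>
    fderiv_mem_tangentHH (smooth_differentiableAt contDiff_graphHH.contDiffAt)
      (Eventually.of_forall graphHH_mem) k
  have hYd : ∀ c k, fderiv ℝ Y c k = fderiv ℝ F (graphHH c) (fderiv ℝ graphHH c k) := by
    intro c k
    exact congrArg (· k) ((smooth_differentiableAt (hFs _ (graphHH_mem c))).hasFDerivAt.comp c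
      (smooth_differentiableAt contDiff_graphHH.contDiffAt).hasFDerivAt).fderiv
  have hmet : ∀ c j k, metric6 (fderiv ℝ graphHH c j) (fderiv ℝ graphHH c k)
      = metric6 (fderiv ℝ Y c j) (fderiv ℝ Y c k) := by
    intro c j k
    rw [hYd, hYd]
    exact (hF.metric _ (graphHH_mem c) _ (hXt c j) _ (hXt c k)).symm
  let t : E2 → (ℝ × ℝ) × (ℝ × ℝ) := fun z => shadow (f z)
  have ht : ContDiffAt ℝ ∞ t y := shadow.contDiff.contDiffAt.comp y hf
  have hfX : f = fun z => graphHH (t z) := funext fun z => (graphHH_shadow (hm z)).symm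
  have hfY : (fun z => F (f z)) = fun z => Y (t z) := by
    funext z
    exact congrArg F (congrFun hfX z)
  have chain : ∀ {Z : (ℝ × ℝ) × (ℝ × ℝ) → R6}, ContDiff ℝ ∞ Z → ∀ u,
      fderiv ℝ (fun z => Z (t z)) y u = fderiv ℝ Z (t y) (fderiv ℝ t y u) := by
    intro Z hZ u
    exact congrArg (· u) ((smooth_differentiableAt hZ.contDiffAt).hasFDerivAt.comp y
      (smooth_differentiableAt ht).hasFDerivAt).fderiv
  refine ⟨(hFs _ (hm y)).comp y hf, fun w hw => ?_⟩
  have hfy : graphHH (t y) = f y := graphHH_shadow (hm y)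
  rw [← hfy] at hw
  -- The witness is the image of `w` under the differential of `F`, expressed through the coordinate
  -- vector `shadow w`.
  refine ⟨fderiv ℝ Y (t y) (shadow w), ?_, fun u => ?_, fun u v => ?_⟩
  · rw [show F (f y) = Y (t y) from congrFun hfY y]
    exact fderiv_mem_tangentHH (smooth_differentiableAt hY.contDiffAt)
      (Eventually.of_forall hYm) _
  · rw [hfY, chain hY, ← hmet, fderiv_graphHH_shadow hw, ← chain contDiff_graphHH, ← hfX]
  · rw [hfY, D2_comp hY.contDiffAt ht, metric6_add_left, ← hmet,
      ← metric6_D2_eq contDiff_graphHH hY hmet, ← metric6_add_left,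
      ← D2_comp contDiff_graphHH.contDiffAt ht, ← hfX, fderiv_graphHH_shadow hw]

/-! ### Total geodesy of products of geodesics and of the diagonal -/

section Surface

variable {M : Type*} [TopologicalSpace M] [ChartedSpace E2 M]
  [IsManifold 𝓘(ℝ, E2) ∞ M] {Φ : M → R6} (hΦ : IsImmersionHH Φ)
include hΦ

/-- Each geodesic lies in a plane through the origin, so `Φ` satisfies two linear equations. Its
tangent vectors and its covariant second derivatives satisfy them too, and the solutions inside the
tangent space of ℍ² × ℍ² form a plane, filled by `diff Φ p`. -/
lemma IsProductOfGeodesics.isTotallyGeodesic (h : IsProductOfGeodesics Φ) :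
    IsTotallyGeodesic Φ := by
  obtain ⟨I₁, I₂, β₁, β₂, h1, h2, U, -, hU⟩ := h
  obtain ⟨x, a, ha, hx⟩ := h1.exists_unitTangent
  obtain ⟨y, b, hb, hy⟩ := h2.exists_unitTangent
  have hmem : ∀ q, Φ q ∈ productOfCurves I₁ I₂ β₁ β₂ := fun q => by
    have : Φ q ∈ U ∩ productOfCurves I₁ I₂ β₁ β₂ := hU ▸ ⟨q, rfl⟩
    exact this.2
  have hn1 : ∀ q, ((minkL (lcross x a)).comp fstL) (Φ q) = 0 := fun q => by
    obtain ⟨s, hs, hs'⟩ := (hmem q).1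
    exact (congrArg (mink (lcross x a)) hs').symm.trans (hx s hs)
  have hn2 : ∀ q, ((minkL (lcross y b)).comp sndL) (Φ q) = 0 := fun q => by
    obtain ⟨s, hs, hs'⟩ := (hmem q).2
    exact (congrArg (mink (lcross y b)) hs').symm.trans (hy s hs)
  intro p u v
  rw [sff_eq_zero_iff hΦ]
  have hs := localRep_smooth hΦ.smooth p (mem_chart_target E2 p)
  have hh : ∀ L : R6 →L[ℝ] ℝ, (∀ q, L (Φ q) = 0) → L (hess Φ p u v) = 0 := by
    intro L hL
    rw [hess_eq, ← D2_clm L hs, show (fun z => L (localRep Φ p z)) = fun _ => 0 from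
      funext fun z => hL _]
    simp [D2]
  let T : Submodule ℝ R6 := tangentSub (Φ p) ⊓
    (LinearMap.ker ((minkL (lcross x a)).comp fstL : R6 →L[ℝ] ℝ).toLinearMap ⊓
      LinearMap.ker ((minkL (lcross y b)).comp sndL : R6 →L[ℝ] ℝ).toLinearMap)
  refine mem_range_of_injective (V := E2) (W := E2) rfl (diff Φ p : E2 →ₗ[ℝ] R6) (hΦ.injective p) T
    (fun w => ⟨diff_tangent hΦ p w, clm_diff_eq_zero hΦ.smooth _ hn1 p w,
      clm_diff_eq_zero hΦ.smooth _ hn2 p w⟩)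
    (pairL ((minkL a).comp fstL) ((minkL b).comp sndL) : R6 →ₗ[ℝ] E2) (fun w hw hw0 => ?_)
    ⟨projHH_mem (hΦ.mem p) _, ?_, ?_⟩
  · obtain ⟨w1, w2⟩ := pairL_eq_iff.1
      ((hw0 : pairL ((minkL a).comp fstL) ((minkL b).comp sndL) w = 0).trans (map_zero _).symm)
    rw [map_zero] at w1 w2
    exact Prod.ext (ha.eq_zero_of_line (hΦ.mem p).1 hw.1.1 hw.2.1 ((mink_comm _ _).trans w1))
      (hb.eq_zero_of_line (hΦ.mem p).2 hw.1.2 hw.2.2 ((mink_comm _ _).trans w2))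
  · change mink (lcross x a) (projHyp _ _) = 0
    have e1 : mink (lcross x a) (hess Φ p u v).1 = 0 := hh _ hn1
    have e2 : mink (lcross x a) (Φ p).1 = 0 := hn1 p
    rw [projHyp, mink_add_right, mink_smul_right, e1, e2]
    ring
  · change mink (lcross y b) (projHyp _ _) = 0
    have e1 : mink (lcross y b) (hess Φ p u v).2 = 0 := hh _ hn2
    have e2 : mink (lcross y b) (Φ p).2 = 0 := hn2 p
    rw [projHyp, mink_add_right, mink_smul_right, e1, e2]
    ring

/-- The second derivatives of `F ∘ Φ` have equal components, so their projections are tangent to the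
diagonal, which by dimension is the range of its differential. `IsIsometryHH.metric6_D2` carries
this back to `Φ`. -/
lemma IsCongruentToDiagonal.isTotallyGeodesic (h : IsCongruentToDiagonal Φ) :
    IsTotallyGeodesic Φ := by
  obtain ⟨F, hF, -, U, -, hU⟩ := h
  have hmem : ∀ q, F (Φ q) ∈ diagonal := fun q => by
    have : F (Φ q) ∈ U ∩ diagonal := hU ▸ ⟨Φ q, ⟨q, rfl⟩, rfl⟩
    exact this.2
  intro p u v
  rw [sff_eq_zero_iff hΦ, hess_eq, diff_eq hΦ.smooth, ← localRep_self Φ p]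
  have hs := localRep_smooth hΦ.smooth p (mem_chart_target E2 p)
  have hinj := hΦ.injective p
  rw [diff_eq hΦ.smooth] at hinj
  set f := localRep Φ p
  set y := chartAt E2 p p
  have hfm : ∀ z, f z ∈ HH := fun z => hΦ.mem _
  obtain ⟨hg, hkey⟩ := hF.metric6_D2 hs hfm
  set g : E2 → R6 := fun z => F (f z) with hgdef
  have hgd : ∀ z, g z ∈ diagonal := fun z => hmem _
  have hgm : ∀ z, g z ∈ HH := fun z => mem_HH_of_mem_diagonal (hgd z)
  have hg0 : (fun z => (fstL - sndL) (g z)) = fun _ => 0 :=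
    funext fun z => sub_eq_zero.2 (mem_diagonal.1 (hgd z)).1
  have hft : ∀ k, fderiv ℝ f y k ∈ tangentHH (f y) :=
    fderiv_mem_tangentHH (smooth_differentiableAt hs) (Eventually.of_forall hfm)
  have hgt : ∀ k, fderiv ℝ g y k ∈ tangentHH (g y) :=
    fderiv_mem_tangentHH (smooth_differentiableAt hg) (Eventually.of_forall hgm)
  have hdiag : ∀ k, (fderiv ℝ g y k).1 = (fderiv ℝ g y k).2 := fun k => by
    have := fderiv_clm (fstL - sndL) (smooth_differentiableAt hg) k
    rw [hg0] at this
    exact sub_eq_zero.1 (by simpa using this.symm)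
  have hdiag2 : (D2 g y u v).1 = (D2 g y u v).2 := by
    have := D2_clm (fstL - sndL) hg u v
    rw [hg0] at this
    exact sub_eq_zero.1 (by simpa [D2] using this.symm)
  have hginj : Function.Injective (fderiv ℝ g y) := by
    rw [injective_iff_map_eq_zero]
    intro k hk
    obtain ⟨w', -, hw', -⟩ := hkey _ (hft k)
    have := hw' k
    rw [hk, metric6_zero_left] at this
    exact (injective_iff_map_eq_zero _).1 hinj k
      (eq_zero_of_metric6_self (hfm y) (hft k) this.symm)
  let T : Submodule ℝ R6 := tangentSub (g y) ⊓
    LinearMap.ker (fstL - sndL : R6 →L[ℝ] R3).toLinearMap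
  have hgy : (g y).1 = (g y).2 := (mem_diagonal.1 (hgd y)).1
  let l : R6 →ₗ[ℝ] E2 := pairL
    (((ContinuousLinearMap.proj (R := ℝ) (φ := fun _ : Fin 3 => ℝ) 1)).comp fstL)
    (((ContinuousLinearMap.proj (R := ℝ) (φ := fun _ : Fin 3 => ℝ) 2)).comp fstL)
  obtain ⟨k, hk⟩ := mem_range_of_injective (V := E2) (W := E2) rfl (fderiv ℝ g y : E2 →ₗ[ℝ] R6)
    hginj T (fun k => ⟨hgt k, sub_eq_zero.2 (hdiag k)⟩) l (fun w hw hw0 => by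
      obtain ⟨w1, w2⟩ := pairL_eq_iff.1 (Eq.trans hw0 (map_zero l).symm)
      have e0 := eq_zero_of_coords (HH.sq_fst (hgm y)) hw.1.1 w1 w2
      have e1 : w.1 = w.2 := sub_eq_zero.1 hw.2
      exact Prod.ext e0 (e1 ▸ e0))
    (w := projHH (g y) (D2 g y u v)) ⟨projHH_mem (hgm y) _, sub_eq_zero.2 (by
      simp [projHH, hdiag2, hgy])⟩
  have hk : fderiv ℝ g y k = projHH (g y) (D2 g y u v) := hk
  -- The parameter vector found for `g` also serves for `f`: pairings with the error `w` equal
  -- pairings of the data of `g` with `w'`, so `w` is orthogonal to itself.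
  refine ⟨k, sub_eq_zero.1 ?_⟩
  set w := fderiv ℝ f y k - projHH (f y) (D2 f y u v) with hw
  have hwt : w ∈ tangentHH (f y) :=
    (tangentSub (f y)).sub_mem (hft k) (projHH_mem (hfm y) _)
  refine eq_zero_of_metric6_self (hfm y) hwt ?_
  obtain ⟨w', hw't, e1, e2⟩ := hkey w hwt
  nth_rw 1 [hw]
  rw [metric6_sub_left, metric6_projHH _ hwt, ← e1, ← e2, hk, metric6_projHH _ hw't, sub_self]

end Surface

end LagHH

end

theorem mainTheorem3 {M : Type*} [TopologicalSpace M] [ConnectedSpace M]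
    [ChartedSpace LagHH.E2 M] [IsManifold 𝓘(ℝ, LagHH.E2) ∞ M]
    (Φ : M → LagHH.R6) (hΦ : LagHH.IsImmersionHH Φ) (hL : LagHH.IsLagrangian Φ) :
    (LagHH.IsTotallyGeodesic Φ ↔
      LagHH.IsProductOfGeodesics Φ ∨ LagHH.IsCongruentToDiagonal Φ) ∧
    (LagHH.IsTotallyUmbilical Φ ↔
      LagHH.IsProductOfGeodesics Φ ∨ LagHH.IsCongruentToDiagonal Φ) := by
  have key : LagHH.IsTotallyGeodesic Φ ↔
      LagHH.IsProductOfGeodesics Φ ∨ LagHH.IsCongruentToDiagonal Φ :=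
    ⟨fun h => h.classification hΦ hL, fun h =>
      h.elim (fun h => h.isTotallyGeodesic hΦ) (fun h => h.isTotallyGeodesic hΦ)⟩
  exact ⟨key, fun h => key.1 (h.isTotallyGeodesic hΦ hL),
    fun h => (key.2 h).isTotallyUmbilical⟩
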